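/- **Setting.** Time points are the rationals. An interval is a convex set of rationals that is empty or has its greatest lower bound and least upper bound in $\mathbb{Q}\cup\{-\infty,\infty\}$. Fix constants (at least one), variables, and predicates with arities. Relational atoms are $P(\mathbf s)$ with $\mathbf s$ a tuple of constants and variables; metric atoms are given by $M ::= \top\mid\bot\mid P(\mathbf s)\mid \diamondsuit^-_\varrho M\mid \diamondsuit^+_\varrho M\mid \boxminus_\varrho M\mid\boxplus_\varrho M\mid M\,\mathcal S_\varrho M\mid M\,\mathcal U_\varrho M$, with $\varrho$ an interval of non-negative rationals. A rule is $M'\leftarrow M_1\wedge\dots\wedge M_n$ with $n\ge1$, each $M_i$ a metric atom, and head $M' ::= \bot\mid P(\mathbf s)\mid\boxminus_\varrho M'\mid\boxplus_\varrho M'$; it is a $\bot$-rule if $\bot$ occurs in its head, and it is safe if each variable of the head has an occurrence in the body outside all left operands of $\mathcal S$ and $\mathcal U$. A program is a finite set of safe rules. A fact is $P(\mathbf c)@\varrho$ with $P(\mathbf c)$ ground and $\varrho$ an interval; a dataset is a finite set of facts. An interpretation $\mathfrak I$ assigns to each $t\in\mathbb Q$ a set of ground relational atoms. Satisfaction $\mathfrak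 I,t\models M$ of ground metric atoms is: always for $\top$; never for $\bot$; membership for relational atoms; $\diamondsuit^-_\varrho M$ (resp. $\boxminus_\varrho M$) iff $\mathfrak I,t'\models M$ for some (resp. all) $t'$ with $t-t'\in\varrho$; $M_1\mathcal S_\varrho M_2$ iff $\mathfrak I,t'\models M_2$ for some $t'$ with $t-t'\in\varrho$ and $\mathfrak I,t''\models M_1$ for all $t''\in(t',t)$; $\diamondsuit^+_\varrho,\boxplus_\varrho,\mathcal U_\varrho$ are the mirror images (with $t'-t\in\varrho$ and $t''\in(t,t')$). $\mathfrak I$ satisfies $M@\varrho$ if $\mathfrak I,t\models M$ for all $t\in\varrho$; it satisfies a rule if, for every ground instance and every $t$, whenever all body atoms hold at $t$ so does the head. $\mathcal D\models M@\varrho$ means that every interpretation satisfying all facts of $\mathcal D$ satisfies $M@\varrho$; $\mathfrak I_{\mathcal D}$ is the least model of $\mathcal D$. $T_\Pi(\mathfrak I)$ is the least interpretation containing $\mathfrak I$ that satisfies the head at $t$ of each ground instance of a non-$\bot$-rule of $\Pi$ whose body atoms all hold in $\mathfrak I$ at $t$. The dependency graph of $\Pi$ has an edge from $Q$ to $R$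 if some rule of $\Pi$ mentions $Q$ in the body and $R$ in the head. A predicate is recursive in $\Pi$ if some path ending in it includes a cycle; a metric atom is non-recursive if all its predicates are non-recursive, and otherwise recursive; the recursive fragment of $\Pi$ is the set of its rules with recursive heads. $\Pi$ is forward-propagating if its rules mention neither $\top$ nor $\bot$, only the past operators $\diamondsuit^-,\boxminus,\mathcal S$ in bodies and only $\boxplus$ in heads. The coalescing $\mathsf{coal}(\mathcal D)$ results from $\mathcal D$ by exhaustively replacing facts $M@\varrho_1,M@\varrho_2$ whose union $\varrho_1\cup\varrho_2$ is an interval by $M@(\varrho_1\cup\varrho_2)$. For a rule $r$ as above, a substitution $\sigma$ and sets of facts $\mathcal D,\Delta$, a tuple $(M_1\sigma@\varrho_1,\dots,M_n\sigma@\varrho_n)$ is an instance for $r$ and $\mathcal D$ relative to $\Delta$ if each $\varrho_i$ is a subset-maximal interval with $\mathcal D\models M_i\sigma@\varrho_i$, and $\mathcal D\setminus\Delta\not\models M_i\sigma@\varrho_i$ for some $i$. It derives the fact $M\sigma@\varrho$, where $M\sigma$ is the relational atom in $M'\sigma$ (if there is one) and $\varrho$ is the subset-maximal interval such that $M'\sigma@(\varrho_1\cap\dots\cap\varrho_n)\models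 M\sigma@\varrho$, provided $\varrho\neq\emptyset$. $\Pi[\mathcal D\,\vdots\,\Delta]$ is the set of all facts so derived by rules $r\in\Pi$. **Optimised seminaïve procedure** on a program $\Pi$, a dataset $\mathcal D$ and a fact $q$. Initialise $\Delta$ and $\mathcal D'$ to $\mathcal D$, $\Pi'$ to $\Pi$, $\mathit{flag}$ to $0$, and for $r\in\Pi$ let $S_r$ be the set of body atoms of $r$ that are non-recursive in $\Pi$. Then loop: 1. $\mathcal N:=\Pi'[\mathcal D'\,\vdots\,\Delta]$; $\mathcal C:=\mathsf{coal}(\mathcal D'\cup\mathcal N)$; $\Delta:=\{f\in\mathcal C : f \text{ entails some fact in }\mathcal N\text{ that is not entailed by }\mathcal D'\}$. 2. If $\mathfrak I_{\mathcal D'}$ does not satisfy some $\bot$-rule of $\Pi$, return $\mathsf{inconst}$; if $\mathcal D'\models q$, return $(\mathsf{true},\mathcal D')$; if $\Delta=\emptyset$, return $(\mathsf{false},\mathcal D')$. 3. If $\mathit{flag}=0$ and $\mathcal D'$, $\mathcal C$ satisfy the same facts over predicates non-recursive in $\Pi'$, set $\mathit{flag}:=1$ and $\Pi'$ to the recursive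 fragment of $\Pi$, and then remove from $\Pi'$ each rule $r$ for which there is $M\in S_r$ such that $\mathcal D'\not\models M\sigma@t$ for all $\sigma$ and $t$. 4. If $\mathit{flag}=1$ and $\Pi'$ is forward-propagating, then for each $r\in\Pi'$ let $t_{\max}^M$ ($M\in S_r$) be the maximum right endpoint of the intervals $\varrho$ with $\mathcal D'\models M\sigma@\varrho$ for some $\sigma$, let $t_r:=\min\{t_{\max}^M : M\in S_r\}$ (with $\min\emptyset=\infty$), and remove $r$ from $\Pi'$ if for each $M@\varrho\in\mathcal C$ with $\varrho\cap(-\infty,t_r]\ne\emptyset$ there is $M@\varrho'\in\mathcal D'$ with $\varrho\cap(-\infty,t_r]\subseteq\varrho'$. 5. $\mathcal D':=\mathcal C$. **Theorem (Soundness and Completeness).** Let $\Pi$ be a program none of whose rules has a vacuously satisfied body (i.e. no ground instance of a body is satisfied in the empty interpretation), let $\mathcal D$ be a dataset and $q$ a fact. For each $k\in\mathbb N$, if the procedure completes $k$ iterations of its loop (without returning), then upon completion of the $k$-th iteration (for $k=0$: after the initialisation) $T_\Pi^k(\mathfrak I_{\mathcal D})=\mathfrak I_{\mathcal D'}$. 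-/

import Mathlib

namespace DatalogMTL

universe u

/-! ### Rational intervals -/

/-- A rational interval: a convex set of rationals which is empty, or whose greatest lower bound and
least upper bound belong to `ℚ ∪ {-∞, ∞}`. -/
def IsInterval (s : Set ℚ) : Prop :=
  s.OrdConnected ∧
    (s.Nonempty → (BddBelow s → ∃ a : ℚ, IsGLB s a) ∧ (BddAbove s → ∃ b : ℚ, IsLUB s b))

/-- Intervals, ordered by inclusion. -/
abbrev Interval : Type := {s : Set ℚ // IsInterval s}

/-- Intervals containing only non-negative rationals; they index the metric operators. -/
abbrev NonnegInterval : Type := {s : Set ℚ // IsInterval s ∧ ∀ q ∈ s, (0 : ℚ) ≤ q}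

/-- The right endpoint (least upper bound) of a set of rationals, an extended number. -/
noncomputable def rightEndpoint (s : Set ℚ) : EReal :=
  sSup ((fun q : ℚ => ((q : ℝ) : EReal)) '' s)

/-- The set of time points in `(-∞, b]`. -/
def timesUpTo (b : EReal) : Set ℚ := {q : ℚ | ((q : ℝ) : EReal) ≤ b}

/-! ### Syntax -/

/-- A signature: constants, variables, and predicates with arities. -/
structure Signature where
  Pred : Type u
  Const : Type u
  Var : Type u
  arity : Pred → ℕ

variable {S : Signature.{u}}

/-- Terms: constants or variables. -/
inductive Term (S : Signature.{u}) where
  | const (c : S.Const)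
  | var (x : S.Var)

/-- Relational atoms with arguments in `τ`; `τ = Term S` for atoms with variables,
`τ = S.Const` for ground atoms. -/
structure Atom (S : Signature.{u}) (τ : Type*) where
  pred : S.Pred
  args : Fin (S.arity pred) → τ

/-- Metric atoms. -/
inductive MAtom (S : Signature.{u}) (τ : Type*) where
  | top
  | bot
  | rel (a : Atom S τ)
  | diamondMinus (ϱ : NonnegInterval) (M : MAtom S τ)
  | diamondPlus (ϱ : NonnegInterval) (M : MAtom S τ)
  | boxMinus (ϱ : NonnegInterval) (M : MAtom S τ)
  | boxPlus (ϱ : NonnegInterval) (M : MAtom S τ)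
  | since (ϱ : NonnegInterval) (M₁ M₂ : MAtom S τ)
  | until (ϱ : NonnegInterval) (M₁ M₂ : MAtom S τ)

/-- Rule heads: the metric atoms generated by `M' ::= ⊥ | P(s) | ⊟ M' | ⊞ M'`. -/
inductive Head (S : Signature.{u}) (τ : Type*) where
  | bot
  | rel (a : Atom S τ)
  | boxMinus (ϱ : NonnegInterval) (H : Head S τ)
  | boxPlus (ϱ : NonnegInterval) (H : Head S τ)

/-- A rule `M' ← M₁ ∧ … ∧ Mₙ` with `n ≥ 1`. -/
structure Rule (S : Signature.{u}) where
  head : Head S (Term S)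
  body : List (MAtom S (Term S))
  body_ne_nil : body ≠ []

/-- Programs are finite sets of (safe) rules. -/
abbrev RuleSet (S : Signature.{u}) := Set (Rule S)

/-- (Ground) substitutions. -/
abbrev Subst (S : Signature.{u}) := S.Var → S.Const

abbrev GroundAtom (S : Signature.{u}) := Atom S S.Const

/-- A fact `P(c)@ϱ`. -/
structure Fact (S : Signature.{u}) where
  atom : GroundAtom S
  ivl : Interval

/-- Sets of facts; a dataset is a finite one. -/
abbrev FactSet (S : Signature.{u}) := Set (Fact S)

def Term.subst (σ : Subst S) : Term S → S.Const
  | .const c => c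
  | .var x => σ x

def Atom.subst (σ : Subst S) (a : Atom S (Term S)) : GroundAtom S :=
  ⟨a.pred, fun i => (a.args i).subst σ⟩

def MAtom.subst (σ : Subst S) : MAtom S (Term S) → MAtom S S.Const
  | .top => .top
  | .bot => .bot
  | .rel a => .rel (a.subst σ)
  | .diamondMinus ϱ M => .diamondMinus ϱ (M.subst σ)
  | .diamondPlus ϱ M => .diamondPlus ϱ (M.subst σ)
  | .boxMinus ϱ M => .boxMinus ϱ (M.subst σ)
  | .boxPlus ϱ M => .boxPlus ϱ (M.subst σ)
  | .since ϱ M₁ M₂ => .since ϱ (M₁.subst σ) (M₂.subst σ)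
  | .until ϱ M₁ M₂ => .until ϱ (M₁.subst σ) (M₂.subst σ)

def Head.subst (σ : Subst S) : Head S (Term S) → Head S S.Const
  | .bot => .bot
  | .rel a => .rel (a.subst σ)
  | .boxMinus ϱ H => .boxMinus ϱ (H.subst σ)
  | .boxPlus ϱ H => .boxPlus ϱ (H.subst σ)

/-- A head is a metric atom. -/
def Head.toMAtom {τ : Type*} : Head S τ → MAtom S τ
  | .bot => .bot
  | .rel a => .rel a
  | .boxMinus ϱ H => .boxMinus ϱ H.toMAtom
  | .boxPlus ϱ H => .boxPlus ϱ H.toMAtom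

/-- The relational atom in a head, if there is one. -/
def Head.relAtom {τ : Type*} : Head S τ → Option (Atom S τ)
  | .bot => none
  | .rel a => some a
  | .boxMinus _ H => H.relAtom
  | .boxPlus _ H => H.relAtom

/-- The predicates mentioned in a metric atom. -/
def MAtom.preds {τ : Type*} : MAtom S τ → Set S.Pred
  | .top => ∅
  | .bot => ∅
  | .rel a => {a.pred}
  | .diamondMinus _ M => M.preds
  | .diamondPlus _ M => M.preds
  | .boxMinus _ M => M.preds
  | .boxPlus _ M => M.preds
  | .since _ M₁ M₂ => M₁.preds ∪ M₂.preds
  | .until _ M₁ M₂ => M₁.preds ∪ M₂.preds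

/-- The variables of a relational atom. -/
def Atom.vars (a : Atom S (Term S)) : Set S.Var := {x | ∃ i, a.args i = .var x}

/-- The variables with an occurrence that is not in a left operand of `since` or `until`. -/
def MAtom.safeVars : MAtom S (Term S) → Set S.Var
  | .top => ∅
  | .bot => ∅
  | .rel a => a.vars
  | .diamondMinus _ M => M.safeVars
  | .diamondPlus _ M => M.safeVars
  | .boxMinus _ M => M.safeVars
  | .boxPlus _ M => M.safeVars
  | .since _ _ M₂ => M₂.safeVars
  | .until _ _ M₂ => M₂.safeVars

/-- Safe rules. -/
def Rule.Safe (r : Rule S) : Prop :=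
  ∀ x ∈ r.head.toMAtom.safeVars, ∃ M ∈ r.body, x ∈ M.safeVars

/-- `⊥`-rules: the head mentions `⊥`, that is, it has no relational atom. -/
def Rule.IsBotRule (r : Rule S) : Prop := r.head.relAtom = none

/-- A body atom mentioning neither `⊤` nor `⊥` and only past operators. -/
def MAtom.PastOnly {τ : Type*} : MAtom S τ → Prop
  | .rel _ => True
  | .diamondMinus _ M => M.PastOnly
  | .boxMinus _ M => M.PastOnly
  | .since _ M₁ M₂ => M₁.PastOnly ∧ M₂.PastOnly
  | _ => False

/-- A head that does not mention `⊥` and mentions only future operators. -/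
def Head.FutureOnly {τ : Type*} : Head S τ → Prop
  | .rel _ => True
  | .boxPlus _ H => H.FutureOnly
  | _ => False

def ForwardPropagating (Γ : RuleSet S) : Prop :=
  ∀ r ∈ Γ, (∀ M ∈ r.body, M.PastOnly) ∧ r.head.FutureOnly

/-- The edges of the dependency graph. -/
def DepEdge (Γ : RuleSet S) (Q R : S.Pred) : Prop :=
  ∃ r ∈ Γ, (∃ M ∈ r.body, Q ∈ M.preds) ∧ R ∈ r.head.toMAtom.preds

/-- `P` is recursive: some path of the dependency graph ends in `P` and includes a cycle. -/
def RecursivePred (Γ : RuleSet S) (P : S.Pred) : Prop :=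
  ∃ Q, Relation.TransGen (DepEdge Γ) Q Q ∧ Relation.ReflTransGen (DepEdge Γ) Q P

/-- A metric atom is non-recursive if so are all its predicates. -/
def NonRecursiveAtom (Γ : RuleSet S) {τ : Type*} (M : MAtom S τ) : Prop :=
  ∀ P ∈ M.preds, ¬ RecursivePred Γ P

/-- The recursive fragment: the rules with recursive atoms in heads. -/
def recursiveFragment (Γ : RuleSet S) : RuleSet S :=
  {r ∈ Γ | ¬ NonRecursiveAtom Γ r.head.toMAtom}

/-! ### Semantics -/

/-- Interpretations, ordered by pointwise inclusion. -/
abbrev Interp (S : Signature.{u}) := ℚ → Set (GroundAtom S)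

/-- Satisfaction of a ground metric atom at a time point. -/
def Sat (I : Interp S) : ℚ → MAtom S S.Const → Prop
  | _, .top => True
  | _, .bot => False
  | t, .rel a => a ∈ I t
  | t, .diamondMinus ϱ M => ∃ t', t - t' ∈ ϱ.1 ∧ Sat I t' M
  | t, .diamondPlus ϱ M => ∃ t', t' - t ∈ ϱ.1 ∧ Sat I t' M
  | t, .boxMinus ϱ M => ∀ t', t - t' ∈ ϱ.1 → Sat I t' M
  | t, .boxPlus ϱ M => ∀ t', t' - t ∈ ϱ.1 → Sat I t' M
  | t, .since ϱ M₁ M₂ =>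
      ∃ t', t - t' ∈ ϱ.1 ∧ Sat I t' M₂ ∧ ∀ t'' ∈ Set.Ioo t' t, Sat I t'' M₁
  | t, .until ϱ M₁ M₂ =>
      ∃ t', t' - t ∈ ϱ.1 ∧ Sat I t' M₂ ∧ ∀ t'' ∈ Set.Ioo t t', Sat I t'' M₁

/-- `I` satisfies `M@s`. -/
def SatOn (I : Interp S) (M : MAtom S S.Const) (s : Set ℚ) : Prop := ∀ t ∈ s, Sat I t M

/-- `I` satisfies the body of the instance of `r` by `σ` at `t`. -/
def SatBody (I : Interp S) (r : Rule S) (σ : Subst S) (t : ℚ) : Prop :=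
  ∀ M ∈ r.body, Sat I t (M.subst σ)

/-- `I` satisfies the rule `r`. -/
def SatRule (I : Interp S) (r : Rule S) : Prop :=
  ∀ (σ : Subst S) (t : ℚ), SatBody I r σ t → Sat I t (r.head.subst σ).toMAtom

def SatFact (I : Interp S) (f : Fact S) : Prop := SatOn I (.rel f.atom) f.ivl.1

def IsModelOf (I : Interp S) (D : FactSet S) : Prop := ∀ f ∈ D, SatFact I f

/-- `D ⊨ M@s`. -/
def Entails (D : FactSet S) (M : MAtom S S.Const) (s : Set ℚ) : Prop :=
  ∀ I : Interp S, IsModelOf I D → SatOn I M s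

def EntailsFact (D : FactSet S) (f : Fact S) : Prop := Entails D (.rel f.atom) f.ivl.1

/-- The least model of a set of facts. -/
def leastModel (D : FactSet S) : Interp S :=
  fun t => {a | ∃ f ∈ D, f.atom = a ∧ t ∈ f.ivl.1}

theorem leastModel_isLeast (D : FactSet S) : IsLeast {I | IsModelOf I D} (leastModel D) := by
  refine ⟨fun f hf t ht => ⟨f, hf, rfl, ht⟩, ?_⟩
  rintro I hI t a ⟨f, hf, rfl, ht⟩
  exact hI f hf t ht

/-- `J` contains `I` and everything derived from `I` by rules in `Γ` that are not `⊥`-rules. -/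
def ClosedUnder (Γ : RuleSet S) (I J : Interp S) : Prop :=
  I ≤ J ∧ ∀ r ∈ Γ, ¬ r.IsBotRule → ∀ (σ : Subst S) (t : ℚ),
    SatBody I r σ t → Sat J t (r.head.subst σ).toMAtom

/-- The immediate consequence operator. -/
def immediateConsequence (Γ : RuleSet S) (I : Interp S) : Interp S :=
  sInf {J | ClosedUnder Γ I J}

theorem Head.relAtom_subst (σ : Subst S) (H : Head S (Term S)) :
    (H.subst σ).relAtom = H.relAtom.map (Atom.subst σ) := by
  induction H with
  | bot => rfl
  | rel a => rfl
  | boxMinus ϱ H ih => exact ih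
  | boxPlus ϱ H ih => exact ih

theorem Head.sat_sInf (A : Set (Interp S)) (H : Head S S.Const) (hH : H.relAtom ≠ none) :
    ∀ t, (∀ J ∈ A, Sat J t H.toMAtom) → Sat (sInf A) t H.toMAtom := by
  induction H with
  | bot => exact absurd rfl hH
  | rel a =>
    intro t h
    simp only [Head.toMAtom, Sat, sInf_apply, Set.iInf_eq_iInter, Set.mem_iInter]
    rintro ⟨J, hJ⟩
    exact h J hJ
  | boxMinus ϱ H ih => exact fun t h t' ht' => ih hH t' fun J hJ => h J hJ t' ht'
  | boxPlus ϱ H ih => exact fun t h t' ht' => ih hH t' fun J hJ => h J hJ t' ht'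

theorem immediateConsequence_isLeast (Γ : RuleSet S) (I : Interp S) :
    IsLeast {J | ClosedUnder Γ I J} (immediateConsequence Γ I) := by
  refine ⟨⟨le_sInf fun J hJ => hJ.1, fun r hr hb σ t h => ?_⟩, fun J hJ => sInf_le hJ⟩
  refine Head.sat_sInf _ _ ?_ t fun J hJ => hJ.2 r hr hb σ t h
  rw [Head.relAtom_subst]
  simpa [Rule.IsBotRule] using hb

/-- The body of `r` is vacuously satisfied, i.e. satisfied in the empty interpretation. -/
def Rule.VacuousBody (r : Rule S) : Prop :=
  ∃ (σ : Subst S) (t : ℚ), SatBody (fun _ => ∅) r σ t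

/-! ### Coalescing -/

/-- The facts obtained from facts in `D` by iteratively coalescing facts over the same atom
whose intervals are union-compatible. -/
inductive Coalesced (D : FactSet S) : Fact S → Prop
  | base (f : Fact S) : f ∈ D → Coalesced D f
  | step (a : GroundAtom S) (ϱ₁ ϱ₂ : Interval) (h : IsInterval (ϱ₁.1 ∪ ϱ₂.1)) :
      Coalesced D ⟨a, ϱ₁⟩ → Coalesced D ⟨a, ϱ₂⟩ → Coalesced D ⟨a, ⟨ϱ₁.1 ∪ ϱ₂.1, h⟩⟩

/-- The coalescing of `D`: the facts obtained by iterative coalescing which cannot be enlarged by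
coalescing them any further. -/
def coal (D : FactSet S) : FactSet S :=
  {f | Coalesced D f ∧ ∀ ϱ : Interval, Coalesced D ⟨f.atom, ϱ⟩ →
    IsInterval (f.ivl.1 ∪ ϱ.1) → ϱ ≤ f.ivl}

/-! ### Rule application -/

/-- `(M₁σ@ϱ₁, …, Mₙσ@ϱₙ)` is an instance for `r` and `D`. -/
def IsInstance (r : Rule S) (D : FactSet S) (σ : Subst S)
    (ϱ : Fin r.body.length → Interval) : Prop :=
  ∀ i, Maximal (fun ϱ' : Interval => Entails D ((r.body.get i).subst σ) ϱ'.1) (ϱ i)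

/-- The instances for `r` and `D` relative to `Δ`. -/
def IsRelInstance (r : Rule S) (D Δ : FactSet S) (σ : Subst S)
    (ϱ : Fin r.body.length → Interval) : Prop :=
  IsInstance r D σ ϱ ∧ ∃ i, ¬ Entails (D \ Δ) ((r.body.get i).subst σ) (ϱ i).1

/-- The facts derived by `r` from `D` relative to `Δ`: facts over the relational atom in the head
and the largest interval on which the head, holding on `ϱ₁ ∩ … ∩ ϱₙ`, makes this atom true.
Void facts, over the empty interval, are left out. There are none for `⊥`-rules. -/
def semiDerived (r : Rule S) (D Δ : FactSet S) : FactSet S :=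
  {f | f.ivl.1.Nonempty ∧ ∃ (σ : Subst S) (ϱ : Fin r.body.length → Interval),
    IsRelInstance r D Δ σ ϱ ∧ (r.head.subst σ).relAtom = some f.atom ∧
    Maximal (fun ϱ' : Interval => ∀ I : Interp S,
      SatOn I (r.head.subst σ).toMAtom (⋂ i, (ϱ i).1) → SatOn I (.rel f.atom) ϱ'.1) f.ivl}

/-- One-step seminaive application `Γ[D ⋮ Δ]`. -/
def semiApply (Γ : RuleSet S) (D Δ : FactSet S) : FactSet S :=
  ⋃ r ∈ Γ, semiDerived r D Δ

/-! ### The optimised seminaive procedure -/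

/-- The contents of the variables between two iterations of the loop. -/
structure State (S : Signature.{u}) where
  /-- the current partial materialisation `D'` -/
  data : FactSet S
  /-- the newly derived facts `Δ` -/
  delta : FactSet S
  /-- the current program `Γ'` -/
  prog : RuleSet S
  flag : Bool

/-- The possible outputs. -/
inductive Output (S : Signature.{u}) where
  | inconst
  | answer (b : Bool) (D : FactSet S)

/-- The procedure has returned an output, or it carries on with a new state. -/
inductive Outcome (S : Signature.{u}) where
  | returned (o : Output S)
  | running (s : State S)

/-- The set `S_r` of body atoms of `r` that are non-recursive in `Γ`. -/
def nonRecBody (Γ : RuleSet S) (r : Rule S) : Set (MAtom S (Term S)) :=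
  {M | M ∈ r.body ∧ NonRecursiveAtom Γ M}

/-- `D` and `C` satisfy the same facts over predicates that are non-recursive in `Γ`. -/
def SameNonRec (Γ : RuleSet S) (D C : FactSet S) : Prop :=
  ∀ f : Fact S, ¬ RecursivePred Γ f.atom.pred → (EntailsFact D f ↔ EntailsFact C f)

/-- The recursive rules of `Γ` without those that have a non-recursive body atom no instance of
which is entailed by `D` at any time point. -/
def pruneNonRec (Γ : RuleSet S) (D : FactSet S) : RuleSet S :=
  {r ∈ recursiveFragment Γ |
    ¬ ∃ M ∈ nonRecBody Γ r, ∀ (σ : Subst S) (t : ℚ), ¬ Entails D (M.subst σ) {t}}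

/-- `t_max^M`: the maximum right endpoint of the intervals on which `D` entails an instance
of `M`. -/
noncomputable def tMax (D : FactSet S) (M : MAtom S (Term S)) : EReal :=
  sSup {e | ∃ (σ : Subst S) (ϱ : Interval), Entails D (M.subst σ) ϱ.1 ∧ e = rightEndpoint ϱ.1}

/-- `t_r`: the minimum of `t_max^M` over `M ∈ S_r` (it is `∞` if `S_r` is empty). -/
noncomputable def tRule (Γ : RuleSet S) (D : FactSet S) (r : Rule S) : EReal :=
  sInf {e | ∃ M ∈ nonRecBody Γ r, e = tMax D M}

/-- Up to the bound `b`, each fact of `C` is already covered by a fact of `D`. -/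
def CompleteUpTo (D C : FactSet S) (b : EReal) : Prop :=
  ∀ f ∈ C, (f.ivl.1 ∩ timesUpTo b).Nonempty →
    ∃ g ∈ D, g.atom = f.atom ∧ f.ivl.1 ∩ timesUpTo b ⊆ g.ivl.1

/-- The rules of `Γ'` that are kept when `Γ'` is forward-propagating. -/
def pruneForward (Γ Γ' : RuleSet S) (D C : FactSet S) : RuleSet S :=
  {r ∈ Γ' | ¬ CompleteUpTo D C (tRule Γ D r)}

open Classical in
/-- One iteration of the loop, on the input program `Γ` and input fact `q`. -/
noncomputable def iteration (Γ : RuleSet S) (q : Fact S) (s : State S) : Outcome S :=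
  let N := semiApply s.prog s.data s.delta
  let C := coal (s.data ∪ N)
  let delta := {f ∈ C | ∃ g ∈ N, EntailsFact {f} g ∧ ¬ EntailsFact s.data g}
  if ∃ r ∈ Γ, r.IsBotRule ∧ ¬ SatRule (leastModel s.data) r then
    .returned .inconst
  else if EntailsFact s.data q then
    .returned (.answer true s.data)
  else if delta = ∅ then
    .returned (.answer false s.data)
  else
    let switch : Prop := s.flag = false ∧ SameNonRec s.prog s.data C
    let flag : Bool := if switch then true else s.flag
    let prog₁ : RuleSet S := if switch then pruneNonRec Γ s.data else s.prog
    let prog₂ : RuleSet S :=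
      if flag = true ∧ ForwardPropagating prog₁ then pruneForward Γ prog₁ s.data C else prog₁
    .running { data := C, delta := delta, prog := prog₂, flag := flag }

/-- The situation of the procedure after `k` iterations of the loop. -/
noncomputable def run (Γ : RuleSet S) (D : FactSet S) (q : Fact S) : ℕ → Outcome S
  | 0 => .running { data := D, delta := D, prog := Γ, flag := false }
  | k + 1 =>
    match run Γ D q k with
    | .returned o => .returned o
    | .running s => iteration Γ q s

end DatalogMTL

namespace DatalogMTL

universe u
variable {S : Signature.{u}}

open scoped Pointwise
open Set

/-! ### Intervals and their finite unions -/

/-! Write `J k` for the `k`-th iterate of the immediate consequence operator on the least model of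
the input. By induction on `k`, the current data have least model `J k`. Three points need an
argument.

Applying a rule through subset-maximal intervals loses nothing. The set of times at which a ground
metric atom holds is a finite union of intervals with endpoints in ℚ ∪ {-∞, ∞} (`Tame`), because
such unions are closed under complement, Minkowski sum and the `since` construction, to which every
metric operator reduces. So each time of truth lies in a maximal interval
(`Tame.exists_maximal_interval`). This requires only finitely many distinct intervals in the data,
however many ground atoms they carry, and rule application and coalescing preserve that.

Restricting to instances relative to `Δ` loses nothing. A skipped instance has its body entailed by
the facts outside `Δ`. After an iteration these hold at the preceding stage
(`leastModel_coal_diff_le`), so the head is already true; initially there are none, and no body is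
vacuously satisfied.

Removing rules loses nothing, because every removed rule is `Exhausted`. Once a step adds nothing
over non-recursive predicates, no later step does (`stableNonRec_of_succ`), since rules for such
predicates have non-recursive bodies. Rules with non-recursive heads then have nothing left to
contribute, and a rule with an unsatisfied non-recursive body atom never fires. For the
forward-propagating test, a body can hold only up to `t_r`. As information never flows backwards in
time, one step without change up to `t_r` means no change there ever (`stage_subset_upTo`). -/

/-- The least upper bound of a set, if it ought to have one, is rational. -/
def HasUpperEnd (s : Set ℚ) : Prop := s.Nonempty → BddAbove s → ∃ b, IsLUB s b

/-- Greatest lower bounds become least upper bounds of `-s`, so endpoint arguments need only be made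
on one side. -/
theorem isInterval_iff {s : Set ℚ} :
    IsInterval s ↔ s.OrdConnected ∧ HasUpperEnd s ∧ HasUpperEnd (-s) := by
  have key : (s.Nonempty → BddBelow s → ∃ a, IsGLB s a) ↔ HasUpperEnd (-s) := by
    simp only [HasUpperEnd, Set.nonempty_neg, bddAbove_neg, isLUB_neg]
    refine forall_congr' fun _ => forall_congr' fun _ => ⟨?_, ?_⟩
    · rintro ⟨a, ha⟩
      exact ⟨-a, by simpa using ha⟩
    · rintro ⟨a, ha⟩
      exact ⟨-a, ha⟩
  rw [← key]
  unfold IsInterval HasUpperEnd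
  tauto

theorem IsInterval.neg {s : Set ℚ} (h : IsInterval s) : IsInterval (-s) := by
  rw [isInterval_iff] at h ⊢
  obtain ⟨h₁, h₂, h₃⟩ := h
  refine ⟨⟨fun x hx y hy z hz => ?_⟩, h₃, by rwa [neg_neg]⟩
  exact h₁.out hy hx ⟨neg_le_neg hz.2, neg_le_neg hz.1⟩

theorem isInterval_empty : IsInterval (∅ : Set ℚ) :=
  ⟨ordConnected_empty, fun h => absurd h Set.not_nonempty_empty⟩

theorem isInterval_singleton (t : ℚ) : IsInterval {t} :=
  ⟨ordConnected_singleton, fun _ => ⟨fun _ => ⟨t, isGLB_singleton⟩, fun _ => ⟨t, isLUB_singleton⟩⟩⟩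

theorem isInterval_univ : IsInterval (univ : Set ℚ) :=
  ⟨ordConnected_univ, fun _ => ⟨fun h => (not_bddBelow_univ h).elim,
    fun h => (not_bddAbove_univ h).elim⟩⟩

theorem isInterval_Ioi (a : ℚ) : IsInterval (Ioi a) :=
  ⟨ordConnected_Ioi, fun _ => ⟨fun _ => ⟨a, isGLB_Ioi⟩, fun h => (not_bddAbove_Ioi a h).elim⟩⟩

theorem upperBounds_inter_of_cofinal {s u : Set ℚ} (hu : u.OrdConnected) (h : (s ∩ u).Nonempty)
    (hsu : ∀ y ∈ s, ∃ z ∈ u, y ≤ z) : upperBounds (s ∩ u) = upperBounds s := by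
  refine Subset.antisymm (fun c hc y hy => ?_) (upperBounds_mono_set inter_subset_left)
  obtain ⟨x, hxs, hxu⟩ := h
  obtain ⟨z, hz, hyz⟩ := hsu y hy
  rcases le_total y x with hyx | hxy
  · exact hyx.trans (hc ⟨hxs, hxu⟩)
  · exact hc ⟨hy, hu.out hxu hz ⟨hxy, hyz⟩⟩

theorem HasUpperEnd.congr {s u : Set ℚ} (hs : HasUpperEnd s) (hne : s.Nonempty)
    (h : upperBounds u = upperBounds s) : HasUpperEnd u := by
  intro _ hb
  unfold HasUpperEnd BddAbove IsLUB at *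
  rw [h] at hb ⊢
  exact hs hne hb

theorem HasUpperEnd.inter {s u : Set ℚ} (hs : s.OrdConnected) (hu : u.OrdConnected)
    (hs' : HasUpperEnd s) (hu' : HasUpperEnd u) : HasUpperEnd (s ∩ u) := by
  intro hne
  by_cases h : ∀ y ∈ s, ∃ z ∈ u, y ≤ z
  · exact hs'.congr (hne.mono inter_subset_left) (upperBounds_inter_of_cofinal hu hne h) hne
  · push Not at h
    obtain ⟨y, hy, hyu⟩ := h
    have := upperBounds_inter_of_cofinal hs (by rwa [inter_comm] at hne)
      fun z hz => ⟨y, hy, (hyu z hz).le⟩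
    rw [inter_comm] at this
    exact hu'.congr (hne.mono inter_subset_right) this hne

theorem IsInterval.inter {s u : Set ℚ} (hs : IsInterval s) (hu : IsInterval u) :
    IsInterval (s ∩ u) := by
  have hs' := isInterval_iff.1 hs.neg
  have hu' := isInterval_iff.1 hu.neg
  rw [isInterval_iff] at hs hu ⊢
  refine ⟨hs.1.inter hu.1, hs.2.1.inter hs.1 hu.1 hu.2.1, ?_⟩
  rw [Set.inter_neg]
  exact hs'.2.1.inter hs'.1 hu'.1 hu'.2.1

theorem isInterval_iInter {ι : Type*} [Finite ι] {f : ι → Set ℚ} (h : ∀ i, IsInterval (f i)) :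
    IsInterval (⋂ i, f i) := by
  have : ∀ J : Set ι, J.Finite → IsInterval (⋂ i ∈ J, f i) := by
    intro J hJ
    induction J, hJ using Set.Finite.induction_on with
    | empty => simpa using isInterval_univ
    | insert _ _ ih => simpa using (h _).inter ih
  simpa using this univ (toFinite _)

theorem HasUpperEnd.add {s u : Set ℚ} (hs : HasUpperEnd s) (hu : HasUpperEnd u) :
    HasUpperEnd (s + u) := by
  rintro ⟨_, x, hx, y, hy, rfl⟩ ⟨c, hc⟩
  have h₁ : BddAbove s := ⟨c - y, fun z hz => by have := hc (add_mem_add hz hy); linarith⟩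
  have h₂ : BddAbove u := ⟨c - x, fun z hz => by have := hc (add_mem_add hx hz); linarith⟩
  obtain ⟨a, ha⟩ := hs ⟨x, hx⟩ h₁
  obtain ⟨b, hb⟩ := hu ⟨y, hy⟩ h₂
  exact ⟨a + b, ha.add hb⟩

theorem IsInterval.add {s u : Set ℚ} (hs : IsInterval s) (hu : IsInterval u) :
    IsInterval (s + u) := by
  rw [isInterval_iff] at hs hu ⊢
  refine ⟨(hs.1.convex.add hu.1.convex : Convex ℚ (s + u)).ordConnected, hs.2.1.add hu.2.1, ?_⟩
  rw [neg_add]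
  exact hs.2.2.add hu.2.2

theorem HasUpperEnd.union {s u : Set ℚ} (hs : HasUpperEnd s) (hu : HasUpperEnd u) :
    HasUpperEnd (s ∪ u) := by
  intro _ hb
  rw [bddAbove_union] at hb
  rcases s.eq_empty_or_nonempty with rfl | hs₀
  · rw [empty_union] at *
    exact hu ‹_› hb.2
  rcases u.eq_empty_or_nonempty with rfl | hu₀
  · rw [union_empty] at *
    exact hs ‹_› hb.1
  obtain ⟨a, ha⟩ := hs hs₀ hb.1
  obtain ⟨b, hb⟩ := hu hu₀ hb.2
  exact ⟨_, ha.union hb⟩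

/-- Finite unions of intervals. -/
def Tame (s : Set ℚ) : Prop := ∃ F : Set (Set ℚ), F.Finite ∧ (∀ C ∈ F, IsInterval C) ∧ s = ⋃₀ F

theorem IsInterval.tame {s : Set ℚ} (hs : IsInterval s) : Tame s :=
  ⟨{s}, finite_singleton _, by simpa using hs, by simp⟩

theorem Tame.union {s u : Set ℚ} : Tame s → Tame u → Tame (s ∪ u) := by
  rintro ⟨F, hF, hF', rfl⟩ ⟨G, hG, hG', rfl⟩
  exact ⟨F ∪ G, hF.union hG, fun C hC => hC.elim (hF' C) (hG' C), sUnion_union F G |>.symm⟩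

theorem Tame.sUnion {F : Set (Set ℚ)} (hF : F.Finite) (h : ∀ C ∈ F, Tame C) : Tame (⋃₀ F) := by
  induction F, hF using Set.Finite.induction_on with
  | empty => simpa using isInterval_empty.tame
  | insert _ _ ih =>
    rw [sUnion_insert]
    exact (h _ (mem_insert _ _)).union (ih fun C hC => h C (mem_insert_of_mem _ hC))

/-- Distributivity over unions reduces a binary operation to the finitely many pairs of pieces. -/
theorem Tame.image2 {op : Set ℚ → Set ℚ → Set ℚ}
    (hop : ∀ F G, op (⋃₀ F) (⋃₀ G) = ⋃₀ (Set.image2 op F G))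
    (hI : ∀ s u, IsInterval s → IsInterval u → IsInterval (op s u)) {s u : Set ℚ} :
    Tame s → Tame u → Tame (op s u) := by
  rintro ⟨F, hF, hF', rfl⟩ ⟨G, hG, hG', rfl⟩
  refine ⟨Set.image2 op F G, hF.image2 _ hG, ?_, hop F G⟩
  rintro _ ⟨s, hs, u, hu, rfl⟩
  exact hI s u (hF' s hs) (hG' u hu)

theorem Tame.inter {s u : Set ℚ} : Tame s → Tame u → Tame (s ∩ u) := by
  refine Tame.image2 (op := (· ∩ ·)) (fun F G => ?_) fun s u => IsInterval.inter
  ext x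
  simp only [mem_inter_iff, mem_sUnion, exists_mem_image2]
  exact ⟨fun ⟨⟨s, hs, hx⟩, u, hu, hx'⟩ => ⟨s, hs, u, hu, hx, hx'⟩,
    fun ⟨s, hs, u, hu, hx, hx'⟩ => ⟨⟨s, hs, hx⟩, u, hu, hx'⟩⟩

theorem Tame.add {s u : Set ℚ} : Tame s → Tame u → Tame (s + u) := by
  refine Tame.image2 (op := (· + ·)) (fun F G => ?_) fun s u => IsInterval.add
  ext x
  simp only [mem_add, mem_sUnion, exists_mem_image2]
  constructor
  · rintro ⟨y, ⟨s, hs, hy⟩, z, ⟨u, hu, hz⟩, rfl⟩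
    exact ⟨s, hs, u, hu, y, hy, z, hz, rfl⟩
  · rintro ⟨s, hs, u, hu, y, hy, z, hz, rfl⟩
    exact ⟨y, ⟨s, hs, hy⟩, z, ⟨u, hu, hz⟩, rfl⟩

theorem Tame.neg {s : Set ℚ} : Tame s → Tame (-s) := by
  rintro ⟨F, hF, hF', rfl⟩
  refine ⟨Neg.neg '' F, hF.image _, ?_, ?_⟩
  · rintro _ ⟨C, hC, rfl⟩
    exact (hF' C hC).neg
  · ext x
    simp

theorem Tame.hasUpperEnd {s : Set ℚ} : Tame s → HasUpperEnd s := by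
  rintro ⟨F, hF, hF', rfl⟩
  induction F, hF using Set.Finite.induction_on with
  | empty => exact fun h => by simp at h
  | insert _ _ ih =>
    rw [sUnion_insert]
    exact (isInterval_iff.1 (hF' _ (mem_insert _ _))).2.1.union
      (ih fun C hC => hF' C (mem_insert_of_mem _ hC))

theorem Tame.isInterval {s : Set ℚ} (hs : Tame s) (h : s.OrdConnected) : IsInterval s :=
  isInterval_iff.2 ⟨h, hs.hasUpperEnd, hs.neg.hasUpperEnd⟩

theorem isInterval_of_isLowerSet {s : Set ℚ} (hs : IsLowerSet s) (h : HasUpperEnd s) :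
    IsInterval s := by
  refine ⟨hs.ordConnected, fun hne => ⟨fun ⟨c, hc⟩ => ?_, h hne⟩⟩
  obtain ⟨x, hx⟩ := hne
  have h₁ := hc (hs (min_le_left x (c - 1)) hx)
  have h₂ := min_le_right x (c - 1)
  linarith

/-! ### Sets of bounds and complements -/

theorem isInterval_lowerBounds {s : Set ℚ} (hs : HasUpperEnd (-s)) :
    IsInterval (lowerBounds s) := by
  refine isInterval_of_isLowerSet (fun a b hba ha x hx => hba.trans (ha hx)) fun hne hb => ?_
  rcases s.eq_empty_or_nonempty with rfl | hs₀
  · simp [not_bddAbove_univ] at hb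
  · obtain ⟨a, ha⟩ := hs (by simpa using hs₀) (bddAbove_neg.2 hne)
    exact ⟨-a, (isLUB_neg.1 ha).isLUB⟩

theorem isInterval_upperBounds {s : Set ℚ} (hs : HasUpperEnd s) :
    IsInterval (upperBounds s) := by
  have := (isInterval_lowerBounds (s := -s) (by rwa [neg_neg])).neg
  convert this using 1
  ext x
  simp only [mem_upperBounds, Set.mem_neg, mem_lowerBounds]
  exact ⟨fun h y hy => by have := h _ hy; linarith, fun h y hy => by
    have := h (-y) (by simpa using hy); linarith⟩

theorem isInterval_strictLowerBounds {s : Set ℚ} (hs : HasUpperEnd (-s)) :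
    IsInterval {x | ∀ y ∈ s, x < y} := by
  refine isInterval_of_isLowerSet (fun a b hba ha x hx => hba.trans_lt (ha x hx)) fun hne hb => ?_
  rcases s.eq_empty_or_nonempty with rfl | hs₀
  · simp [not_bddAbove_univ] at hb
  · obtain ⟨x, hx⟩ := hne
    obtain ⟨a, ha⟩ := hs (by simpa using hs₀)
      (bddAbove_neg.2 ⟨x, fun y hy => (hx y hy).le⟩)
    have ha := isLUB_neg.1 ha
    refine ⟨-a, fun z hz => ha.2 fun y hy => (hz y hy).le, fun c hc => ?_⟩
    -- By density of ℚ, strict lower bounds come arbitrarily close to the infimum of `s`.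
    by_contra! hlt
    obtain ⟨z, hz₁, hz₂⟩ := exists_between hlt
    exact absurd (hc (show z ∈ _ from fun y hy => hz₂.trans_le (ha.1 hy))) hz₁.not_ge

theorem IsInterval.tame_compl {s : Set ℚ} (hs : IsInterval s) : Tame sᶜ := by
  rcases s.eq_empty_or_nonempty with rfl | hne
  · simpa using isInterval_univ.tame
  have h₁ := isInterval_strictLowerBounds (isInterval_iff.1 hs).2.2
  have h₂ := (isInterval_strictLowerBounds (isInterval_iff.1 hs.neg).2.2).neg
  have : sᶜ = {x | ∀ y ∈ s, x < y} ∪ -{x | ∀ y ∈ -s, x < y} := by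
    ext x
    simp only [mem_compl_iff, mem_union, mem_ofPred_eq, Set.mem_neg]
    constructor
    · intro hx
      by_contra! h
      obtain ⟨⟨y, hy, hyx⟩, z, hz, hzx⟩ := h
      exact hx (hs.1.out hy hz ⟨hyx, by linarith⟩)
    · rintro (h | h) hx
      · exact lt_irrefl _ (h x hx)
      · exact lt_irrefl _ (h (-x) (by simpa using hx))
  rw [this]
  exact h₁.tame.union h₂.tame

theorem Tame.compl {s : Set ℚ} : Tame s → Tame sᶜ := by
  rintro ⟨F, hF, hF', rfl⟩
  induction F, hF using Set.Finite.induction_on with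
  | empty => simpa using isInterval_univ.tame
  | insert _ _ ih =>
    rw [sUnion_insert, compl_union]
    exact (hF' _ (mem_insert _ _)).tame_compl.inter (ih fun C hC => hF' C (mem_insert_of_mem _ hC))

/-- The time points at which `since`, with operands holding on `A` and `B`, holds. -/
def sinceSet (ϱ A B : Set ℚ) : Set ℚ :=
  {t | ∃ t', t - t' ∈ ϱ ∧ t' ∈ B ∧ ∀ t'' ∈ Ioo t' t, t'' ∈ A}

/-- `F` lists the convex pieces where the left operand fails. If `(t', t)` avoids them all,
convexity puts each piece entirely at or after `t` (those in `J`) or at or before `t'`. For fixed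
`J` the two conditions decouple, leaving a bound on `t` and a Minkowski sum. When `t' = t` the gap
is empty and imposes nothing, hence the separate first set. -/
theorem sinceSet_eq {ϱ B : Set ℚ} (hϱ : ∀ x ∈ ϱ, 0 ≤ x) {F : Set (Set ℚ)}
    (hF : ∀ C ∈ F, C.OrdConnected) :
    sinceSet ϱ (⋃₀ F)ᶜ B = {t | t ∈ B ∧ (0 : ℚ) ∈ ϱ} ∪
      ⋃₀ ((fun J => lowerBounds (⋃₀ J) ∩
        ((B ∩ upperBounds (⋃₀ (F \ J))) + (ϱ ∩ Ioi 0))) '' 𝒫 F) := by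
  ext t
  simp only [mem_union, mem_ofPred_eq, mem_sUnion, exists_mem_image, mem_inter_iff]
  constructor
  · rintro ⟨t', ht, htB, h⟩
    rcases (sub_nonneg.1 (hϱ _ ht)).eq_or_lt with rfl | hlt
    · exact Or.inl ⟨htB, by simpa using ht⟩
    refine Or.inr ⟨{C ∈ F | t ∈ lowerBounds C}, fun C hC => hC.1, ?_,
      ⟨t', ⟨htB, ?_⟩, t - t', ⟨ht, sub_pos.2 hlt⟩, by ring⟩⟩
    · rintro x ⟨C, hC, hx⟩
      exact hC.2 hx
    · rintro x ⟨C, ⟨hC, hC'⟩, hx⟩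
      -- A piece outside `J` has a point before `t`, hence at or before `t'`. A further point beyond
      -- `t'` would, by convexity, put part of the piece inside the gap.
      have hC' : ∃ y ∈ C, y < t := by
        by_contra! hcon
        exact hC' ⟨hC, fun y hy => hcon y hy⟩
      obtain ⟨y, hy, hyt⟩ := hC'
      by_contra! hxt
      have hyt' : y ≤ t' := by
        by_contra! h'
        exact h y ⟨h', hyt⟩ ⟨C, hC, hy⟩
      obtain ⟨z, hz₁, hz₂⟩ := exists_between (lt_min hxt hlt)
      exact h z ⟨hz₁, hz₂.trans_le (min_le_right _ _)⟩
        ⟨C, hC, (hF C hC).out hy hx ⟨hyt'.trans hz₁.le, hz₂.le.trans (min_le_left _ _)⟩⟩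
  · rintro (⟨htB, h0⟩ | ⟨J, hJ, hlow, t', ⟨ht'B, hup⟩, r, ⟨hr, hr0⟩, rfl⟩)
    · exact ⟨t, by simpa using h0, htB, fun t'' h => absurd (h.1.trans h.2) (lt_irrefl _)⟩
    · refine ⟨t', by simpa using hr, ht'B, ?_⟩
      rintro z ⟨hz₁, hz₂⟩ ⟨C, hC, hzC⟩
      by_cases hCJ : C ∈ J
      · exact absurd (hlow ⟨C, hCJ, hzC⟩) hz₂.not_ge
      · exact absurd (hup ⟨C, ⟨hC, hCJ⟩, hzC⟩) hz₁.not_ge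

theorem Tame.sinceSet {ϱ A B : Set ℚ} (hϱ : IsInterval ϱ) (hϱ' : ∀ x ∈ ϱ, 0 ≤ x) (hA : Tame A)
    (hB : Tame B) : Tame (sinceSet ϱ A B) := by
  obtain ⟨F, hF, hF', hAF⟩ := hA.compl
  rw [compl_eq_comm] at hAF
  rw [← hAF, sinceSet_eq hϱ' fun C hC => (hF' C hC).1]
  have htame : ∀ J ⊆ F, Tame (⋃₀ J) := fun J hJ => ⟨J, hF.subset hJ, fun C hC => hF' C (hJ hC), rfl⟩
  refine Tame.union ?_ (Tame.sUnion (hF.finite_subsets.image _) ?_)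
  · by_cases h : (0 : ℚ) ∈ ϱ
    · simpa [h] using hB
    · simpa [h] using isInterval_empty.tame
  · rintro _ ⟨J, hJ, rfl⟩
    exact (isInterval_lowerBounds (htame J hJ).neg.hasUpperEnd).tame.inter
      ((hB.inter (isInterval_upperBounds (htame _ sdiff_subset).hasUpperEnd).tame).add
        (hϱ.inter (isInterval_Ioi 0)).tame)

/-! ### Connected components -/

theorem ordConnected_ordConnectedComponent (A : Set ℚ) (t : ℚ) :
    (ordConnectedComponent A t).OrdConnected := inferInstance

theorem finite_range_sUnion {α : Type*} {F : Set (Set α)} (hF : F.Finite) :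
    {s : Set α | ∃ G ⊆ F, s = ⋃₀ G}.Finite :=
  (hF.finite_subsets.image sUnion).subset fun _ ⟨G, hG, h⟩ => ⟨G, hG, h.symm⟩

/-- A convex piece that meets a component lies inside it. So finitely many pieces give finitely many
components, each again a finite union of intervals. -/
theorem ordConnectedComponent_sUnion {F : Set (Set ℚ)} (hF : ∀ C ∈ F, C.OrdConnected) (t : ℚ) :
    ordConnectedComponent (⋃₀ F) t = ⋃₀ {C ∈ F | C ⊆ ordConnectedComponent (⋃₀ F) t} := by
  refine Subset.antisymm (fun x hx => ?_) (sUnion_subset fun C hC => hC.2)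
  obtain ⟨C, hC, hxC⟩ := ordConnectedComponent_subset hx
  refine ⟨C, ⟨hC, fun y hy => mem_ordConnectedComponent_trans hx ?_⟩, hxC⟩
  have := hF C hC
  exact subset_ordConnectedComponent hxC (subset_sUnion_of_mem hC) hy

theorem Tame.finite_components {A : Set ℚ} (hA : Tame A) :
    (range (ordConnectedComponent A)).Finite := by
  obtain ⟨F, hF, hF', rfl⟩ := hA
  refine (finite_range_sUnion hF).subset ?_
  rintro _ ⟨t, rfl⟩
  exact ⟨_, sep_subset _ _, ordConnectedComponent_sUnion (fun C hC => (hF' C hC).1) t⟩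

theorem Tame.isInterval_component {A : Set ℚ} (hA : Tame A) (t : ℚ) :
    IsInterval (ordConnectedComponent A t) := by
  obtain ⟨F, hF, hF', rfl⟩ := hA
  refine Tame.isInterval ?_ (ordConnected_ordConnectedComponent _ t)
  exact ⟨_, hF.subset (sep_subset _ _), fun C hC => hF' C hC.1,
    ordConnectedComponent_sUnion (fun C hC => (hF' C hC).1) t⟩

theorem Tame.exists_maximal_interval {A : Set ℚ} (hA : Tame A) {t : ℚ} (ht : t ∈ A) :
    ∃ ϱ : Interval, t ∈ ϱ.1 ∧ Maximal (fun ϱ' : Interval => ϱ'.1 ⊆ A) ϱ := by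
  have hmem : t ∈ ordConnectedComponent A t := self_mem_ordConnectedComponent.2 ht
  refine ⟨⟨_, hA.isInterval_component t⟩, hmem, ordConnectedComponent_subset, fun ϱ h hle => ?_⟩
  have := ϱ.2.1
  exact subset_ordConnectedComponent (hle hmem) h

theorem Tame.finite_maximal_intervals {A : Set ℚ} (hA : Tame A) :
    {ϱ : Interval | Maximal (fun ϱ' : Interval => ϱ'.1 ⊆ A) ϱ}.Finite := by
  -- A nonempty maximal interval is a component; the extra `∅` accounts for the maximal interval of
  -- an empty set.
  refine ((hA.finite_components.union (finite_singleton ∅)).preimage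
    (Subtype.val_injective.injOn)).subset fun ϱ hϱ => ?_
  rcases ϱ.1.eq_empty_or_nonempty with h | ⟨t, ht⟩
  · exact Or.inr h
  · have := ϱ.2.1
    have hle : ϱ ≤ ⟨_, hA.isInterval_component t⟩ := subset_ordConnectedComponent ht hϱ.1
    have hge := hϱ.2 (y := ⟨_, hA.isInterval_component t⟩) ordConnectedComponent_subset hle
    exact Or.inl ⟨t, (Subset.antisymm hle hge).symm⟩

/-! ### Satisfaction -/

theorem MAtom.preds_subst (σ : Subst S) (M : MAtom S (Term S)) : (M.subst σ).preds = M.preds := by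
  induction M <;> simp_all [MAtom.subst, MAtom.preds, Atom.subst]

theorem MAtom.PastOnly.subst (σ : Subst S) {M : MAtom S (Term S)} (h : M.PastOnly) :
    (M.subst σ).PastOnly := by
  induction M <;> simp_all [MAtom.subst, MAtom.PastOnly]

theorem Head.FutureOnly.subst (σ : Subst S) {H : Head S (Term S)} (h : H.FutureOnly) :
    (H.subst σ).FutureOnly := by
  induction H <;> simp_all [Head.subst, Head.FutureOnly]

theorem Sat.of_preds {I J : Interp S} {M : MAtom S S.Const}
    (h : ∀ a t, a.pred ∈ M.preds → a ∈ I t → a ∈ J t) {t : ℚ} (hM : Sat I t M) : Sat J t M := by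
  induction M generalizing t with
  | top => trivial
  | bot => exact hM
  | rel a => exact h a t rfl hM
  | diamondMinus ϱ M ih | diamondPlus ϱ M ih =>
    obtain ⟨t', ht, hM⟩ := hM
    exact ⟨t', ht, ih h hM⟩
  | boxMinus ϱ M ih | boxPlus ϱ M ih => exact fun t' ht => ih h (hM t' ht)
  | _ =>
    rename_i ϱ M₁ M₂ ih₁ ih₂
    obtain ⟨t', ht, hM₂, hM₁⟩ := hM
    exact ⟨t', ht, ih₂ (fun a t ha => h a t (Or.inr ha)) hM₂,
      fun t'' ht'' => ih₁ (fun a t ha => h a t (Or.inl ha)) (hM₁ t'' ht'')⟩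

theorem Sat.mono {I J : Interp S} (h : I ≤ J) {M : MAtom S S.Const} {t : ℚ} (hM : Sat I t M) :
    Sat J t M :=
  hM.of_preds fun _ t _ ha => h t ha

/-- Operator ranges are non-negative, so past operators look only at times up to `t`. -/
theorem Sat.of_past {I J : Interp S} {M : MAtom S S.Const} (hp : M.PastOnly) {t : ℚ}
    (h : ∀ t' ≤ t, I t' ⊆ J t') (hM : Sat I t M) : Sat J t M := by
  have hle : ∀ (ϱ : NonnegInterval) {t t' : ℚ}, t - t' ∈ ϱ.1 → t' ≤ t :=
    fun ϱ _ _ h => sub_nonneg.1 (ϱ.2.2 _ h)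
  induction M generalizing t with
  | rel a => exact h t le_rfl hM
  | diamondMinus ϱ M ih =>
    obtain ⟨t', ht, hM⟩ := hM
    exact ⟨t', ht, ih hp (fun s hs => h s (hs.trans (hle ϱ ht))) hM⟩
  | boxMinus ϱ M ih =>
    exact fun t' ht => ih hp (fun s hs => h s (hs.trans (hle ϱ ht))) (hM t' ht)
  | since ϱ M₁ M₂ ih₁ ih₂ =>
    obtain ⟨t', ht, hM₂, hM₁⟩ := hM
    exact ⟨t', ht, ih₂ hp.2 (fun s hs => h s (hs.trans (hle ϱ ht))) hM₂,
      fun t'' ht'' => ih₁ hp.1 (fun s hs => h s (hs.trans ht''.2.le)) (hM₁ t'' ht'')⟩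
  | _ => exact hp.elim

theorem Head.sat_of_future {I : Interp S} {H : Head S S.Const} (hH : H.FutureOnly) {t : ℚ}
    (h : ∀ t' ≥ t, I t' = univ) : Sat I t H.toMAtom := by
  induction H generalizing t with
  | rel a =>
    change a ∈ I t
    simp [h t le_rfl]
  | boxPlus ϱ H ih =>
    exact fun t' ht => ih hH fun s hs => h s ((sub_nonneg.1 (ϱ.2.2 _ ht)).trans hs)
  | _ => exact hH.elim

theorem SatBody.mono {I J : Interp S} (h : I ≤ J) {r : Rule S} {σ : Subst S} {t : ℚ}
    (hr : SatBody I r σ t) : SatBody J r σ t :=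
  fun M hM => (hr M hM).mono h

/-- The time points at which a metric atom holds. -/
def satSet (I : Interp S) (M : MAtom S S.Const) : Set ℚ := {t | Sat I t M}

/-- Satisfaction is monotone in the interpretation, so the least model decides entailment. -/
theorem entails_iff {D : FactSet S} {M : MAtom S S.Const} {s : Set ℚ} :
    Entails D M s ↔ s ⊆ satSet (leastModel D) M :=
  ⟨fun h t ht => h _ (leastModel_isLeast D).1 t ht,
    fun h _ hI _ ht => Sat.mono ((leastModel_isLeast D).2 hI) (h ht)⟩

theorem entailsFact_iff {D : FactSet S} {f : Fact S} :
    EntailsFact D f ↔ ∀ t ∈ f.ivl.1, f.atom ∈ leastModel D t :=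
  entails_iff

/-- Time reversal turns `since` into `until`. With a trivial left operand for diamonds and
complements for boxes, this reduces all six operators to `sinceSet`. -/
theorem neg_sinceSet_neg (ϱ A B : Set ℚ) :
    -sinceSet ϱ (-A) (-B) =
      {t | ∃ t', t' - t ∈ ϱ ∧ t' ∈ B ∧ ∀ t'' ∈ Ioo t t', t'' ∈ A} := by
  ext t
  simp only [sinceSet, Set.mem_neg, mem_ofPred_eq]
  constructor
  · rintro ⟨t', h₁, h₂, h₃⟩
    refine ⟨-t', by convert h₁ using 1; ring, h₂, fun t'' h => ?_⟩
    simpa using h₃ (-t'') ⟨by linarith [h.2], by linarith [h.1]⟩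
  · rintro ⟨t', h₁, h₂, h₃⟩
    refine ⟨-t', by convert h₁ using 1; ring, by simpa using h₂, fun t'' h => ?_⟩
    exact h₃ (-t'') ⟨by linarith [h.2], by linarith [h.1]⟩

theorem satSet_diamondMinus (I : Interp S) (ϱ : NonnegInterval) (M : MAtom S S.Const) :
    satSet I (.diamondMinus ϱ M) = sinceSet ϱ.1 univ (satSet I M) := by
  ext t
  simp [satSet, sinceSet, Sat]

theorem satSet_diamondPlus (I : Interp S) (ϱ : NonnegInterval) (M : MAtom S S.Const) :
    satSet I (.diamondPlus ϱ M) = -sinceSet ϱ.1 (-univ) (-satSet I M) := by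
  rw [neg_sinceSet_neg]
  ext t
  simp [satSet, Sat]

theorem satSet_boxMinus (I : Interp S) (ϱ : NonnegInterval) (M : MAtom S S.Const) :
    satSet I (.boxMinus ϱ M) = (sinceSet ϱ.1 univ (satSet I M)ᶜ)ᶜ := by
  ext t
  simp [satSet, sinceSet, Sat]

theorem satSet_boxPlus (I : Interp S) (ϱ : NonnegInterval) (M : MAtom S S.Const) :
    satSet I (.boxPlus ϱ M) = (-sinceSet ϱ.1 (-univ) (-(satSet I M)ᶜ))ᶜ := by
  rw [neg_sinceSet_neg]
  ext t
  simp [satSet, Sat]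

theorem satSet_since (I : Interp S) (ϱ : NonnegInterval) (M₁ M₂ : MAtom S S.Const) :
    satSet I (.since ϱ M₁ M₂) = sinceSet ϱ.1 (satSet I M₁) (satSet I M₂) := rfl

theorem satSet_until (I : Interp S) (ϱ : NonnegInterval) (M₁ M₂ : MAtom S S.Const) :
    satSet I (.until ϱ M₁ M₂) = -sinceSet ϱ.1 (-satSet I M₁) (-satSet I M₂) := by
  rw [neg_sinceSet_neg]
  rfl

/-- The relational atoms hold on finite unions of intervals, taken from a finite collection. -/
theorem satSet_rel_leastModel (D : FactSet S) (a : GroundAtom S) :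
    satSet (leastModel D) (.rel a) =
      ⋃₀ (Subtype.val '' (Fact.ivl '' {f ∈ D | f.atom = a})) := by
  ext t
  simp only [satSet, Sat, leastModel, mem_ofPred_eq, mem_sUnion, exists_mem_image, and_assoc]

theorem tame_satSet {D : FactSet S} (hD : (Fact.ivl '' D).Finite) (M : MAtom S S.Const) :
    Tame (satSet (leastModel D) M) := by
  have huniv : Tame (univ : Set ℚ) := isInterval_univ.tame
  induction M with
  | top => exact huniv
  | bot => exact isInterval_empty.tame
  | rel a =>
    refine ⟨_, ?_, ?_, satSet_rel_leastModel D a⟩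
    · exact (hD.subset (image_mono (sep_subset _ _))).image _
    · rintro _ ⟨ϱ, -, rfl⟩
      exact ϱ.2
  | diamondMinus ϱ M ih =>
    rw [satSet_diamondMinus]
    exact huniv.sinceSet ϱ.2.1 ϱ.2.2 ih
  | diamondPlus ϱ M ih =>
    rw [satSet_diamondPlus]
    exact (huniv.neg.sinceSet ϱ.2.1 ϱ.2.2 ih.neg).neg
  | boxMinus ϱ M ih =>
    rw [satSet_boxMinus]
    exact (huniv.sinceSet ϱ.2.1 ϱ.2.2 ih.compl).compl
  | boxPlus ϱ M ih =>
    rw [satSet_boxPlus]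
    exact (huniv.neg.sinceSet ϱ.2.1 ϱ.2.2 ih.compl.neg).neg.compl
  | since ϱ M₁ M₂ ih₁ ih₂ => exact ih₁.sinceSet ϱ.2.1 ϱ.2.2 ih₂
  | _ =>
    rename_i ϱ M₁ M₂ ih₁ ih₂
    rw [satSet_until]
    exact (ih₁.neg.sinceSet ϱ.2.1 ϱ.2.2 ih₂.neg).neg

/-- There may be infinitely many ground instances, but a relational atom can hold only on a union of
some of the finitely many intervals in `D`, and each operator acts on truth sets alone. -/
theorem finite_range_satSet {D : FactSet S} (hD : (Fact.ivl '' D).Finite)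
    (M : MAtom S (Term S)) :
    (range fun σ : Subst S => satSet (leastModel D) (M.subst σ)).Finite := by
  have unary : ∀ {M : MAtom S (Term S)} {op : MAtom S S.Const → MAtom S S.Const}
      {g : Set ℚ → Set ℚ}, (∀ N, satSet (leastModel D) (op N) = g (satSet (leastModel D) N)) →
      (range fun σ : Subst S => satSet (leastModel D) (M.subst σ)).Finite →
      (range fun σ : Subst S => satSet (leastModel D) (op (M.subst σ))).Finite := by
    intro M op g hop h
    refine (h.image g).subset ?_
    rintro _ ⟨σ, rfl⟩
    exact ⟨_, ⟨σ, rfl⟩, (hop _).symm⟩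
  have binary : ∀ {M₁ M₂ : MAtom S (Term S)} {op : MAtom S S.Const → MAtom S S.Const →
      MAtom S S.Const} {g : Set ℚ → Set ℚ → Set ℚ},
      (∀ N₁ N₂, satSet (leastModel D) (op N₁ N₂) =
        g (satSet (leastModel D) N₁) (satSet (leastModel D) N₂)) →
      (range fun σ : Subst S => satSet (leastModel D) (M₁.subst σ)).Finite →
      (range fun σ : Subst S => satSet (leastModel D) (M₂.subst σ)).Finite →
      (range fun σ : Subst S => satSet (leastModel D) (op (M₁.subst σ) (M₂.subst σ))).Finite := by
    intro M₁ M₂ op g hop h₁ h₂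
    refine (h₁.image2 g h₂).subset ?_
    rintro _ ⟨σ, rfl⟩
    exact ⟨_, ⟨σ, rfl⟩, _, ⟨σ, rfl⟩, (hop _ _).symm⟩
  induction M with
  | top => exact (finite_singleton _).subset (range_subset_iff.2 fun _ => mem_singleton univ)
  | bot => exact (finite_singleton _).subset (range_subset_iff.2 fun _ => mem_singleton ∅)
  | rel a =>
    refine (finite_range_sUnion (hD.image Subtype.val)).subset ?_
    rintro _ ⟨σ, rfl⟩
    exact ⟨_, image_mono (image_mono (sep_subset _ _)), satSet_rel_leastModel D _⟩
  | diamondMinus ϱ M ih => exact unary (satSet_diamondMinus _ ϱ) ih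
  | diamondPlus ϱ M ih =>
    exact unary (g := fun A => -sinceSet ϱ.1 (-univ) (-A)) (satSet_diamondPlus _ ϱ) ih
  | boxMinus ϱ M ih => exact unary (g := fun A => (sinceSet ϱ.1 univ Aᶜ)ᶜ) (satSet_boxMinus _ ϱ) ih
  | boxPlus ϱ M ih =>
    exact unary (g := fun A => (-sinceSet ϱ.1 (-univ) (-Aᶜ))ᶜ) (satSet_boxPlus _ ϱ) ih
  | since ϱ M₁ M₂ ih₁ ih₂ => exact binary (satSet_since _ ϱ) ih₁ ih₂
  | _ =>
    rename_i ϱ M₁ M₂ ih₁ ih₂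
    exact binary (g := fun A B => -sinceSet ϱ.1 (-A) (-B)) (satSet_until _ ϱ) ih₁ ih₂

/-! ### Coalescing -/

theorem Coalesced.subset_leastModel {D : FactSet S} {f : Fact S} (h : Coalesced D f) :
    ∀ t ∈ f.ivl.1, f.atom ∈ leastModel D t := by
  induction h with
  | base f hf => exact fun t ht => ⟨f, hf, rfl, ht⟩
  | step a ϱ₁ ϱ₂ h _ _ ih₁ ih₂ => exact fun t ht => ht.elim (ih₁ t) (ih₂ t)

theorem Coalesced.exists_sUnion {D : FactSet S} {f : Fact S} (h : Coalesced D f) :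
    ∃ G : Set (Fact S), G ⊆ D ∧ (∀ g ∈ G, g.atom = f.atom) ∧
      f.ivl.1 = ⋃₀ ((fun g : Fact S => g.ivl.1) '' G) := by
  induction h with
  | base f hf => exact ⟨{f}, by simpa using hf, by simp, by simp⟩
  | step a ϱ₁ ϱ₂ h _ _ ih₁ ih₂ =>
    obtain ⟨G₁, hG₁, ha₁, h₁⟩ := ih₁
    obtain ⟨G₂, hG₂, ha₂, h₂⟩ := ih₂
    refine ⟨G₁ ∪ G₂, union_subset hG₁ hG₂, fun g hg => hg.elim (ha₁ g) (ha₂ g), ?_⟩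
    rw [image_union, sUnion_union, ← h₁, ← h₂]

theorem finite_ivl_coalesced {D : FactSet S} (hD : (Fact.ivl '' D).Finite) :
    (Fact.ivl '' {f | Coalesced D f}).Finite := by
  refine ((finite_range_sUnion (hD.image Subtype.val)).preimage
    Subtype.val_injective.injOn).subset ?_
  rintro _ ⟨f, hf, rfl⟩
  obtain ⟨G, hG, -, h⟩ := Coalesced.exists_sUnion hf
  refine ⟨_, ?_, h⟩
  rintro _ ⟨g, hg, rfl⟩
  exact ⟨g.ivl, ⟨g, hG hg, rfl⟩, rfl⟩

theorem finite_ivl_coal {D : FactSet S} (hD : (Fact.ivl '' D).Finite) :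
    (Fact.ivl '' coal D).Finite :=
  (finite_ivl_coalesced hD).subset (image_mono fun _ hf => hf.1)

theorem leastModel_coal {D : FactSet S} (hD : (Fact.ivl '' D).Finite) :
    leastModel (coal D) = leastModel D := by
  refine le_antisymm ?_ ?_
  · rintro t _ ⟨f, hf, rfl, ht⟩
    exact hf.1.subset_leastModel t ht
  · rintro t _ ⟨f, hf, rfl, ht⟩
    -- Finiteness provides a maximal coalesced interval above the given one. It admits no further
    -- coalescing, since a union would be a larger coalesced interval.
    have hfin : {ϱ : Interval | Coalesced D ⟨f.atom, ϱ⟩}.Finite :=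
      (finite_ivl_coalesced hD).subset fun ϱ hϱ => ⟨_, hϱ, rfl⟩
    obtain ⟨ϱ, hle, hmax⟩ := hfin.exists_le_maximal (a := f.ivl) (Coalesced.base f hf)
    refine ⟨⟨f.atom, ϱ⟩, ⟨hmax.1, fun ϱ' hϱ' hint => ?_⟩, rfl, hle ht⟩
    have := hmax.2 (Coalesced.step _ _ _ hint hmax.1 hϱ') (show ϱ.1 ⊆ _ from subset_union_left)
    exact (show ϱ'.1 ⊆ ϱ.1 from subset_union_right.trans this)

/-- The facts of the coalescing that do not entail a new fact were there before. -/
theorem leastModel_coal_diff_le (D N : FactSet S) :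
    leastModel (coal (D ∪ N) \
      {f ∈ coal (D ∪ N) | ∃ g ∈ N, EntailsFact {f} g ∧ ¬ EntailsFact D g}) ≤ leastModel D := by
  rintro t _ ⟨f, ⟨hf, hnew⟩, rfl, ht⟩
  obtain ⟨G, hG, hatom, hivl⟩ := hf.1.exists_sUnion
  rw [hivl] at ht
  obtain ⟨_, ⟨g, hg, rfl⟩, htg⟩ := ht
  rcases hG hg with hgD | hgN
  · exact ⟨g, hgD, hatom g hg, htg⟩
  · have hfg : EntailsFact {f} g := by
      refine entailsFact_iff.2 fun t' ht' => ⟨f, rfl, (hatom g hg).symm, ?_⟩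
      rw [hivl]
      exact ⟨_, ⟨g, hg, rfl⟩, ht'⟩
    have hDg : EntailsFact D g := by
      by_contra hcon
      exact hnew ⟨hf, g, hgN, hfg, hcon⟩
    rw [← hatom g hg]
    exact entailsFact_iff.1 hDg t htg

/-! ### Rule application -/

/-- The time points at which the relational atom of a head holds if the head holds on `s`. -/
def Head.shift {τ : Type*} : Head S τ → Set ℚ → Set ℚ
  | .bot, s => s
  | .rel _, s => s
  | .boxMinus ϱ H, s => H.shift (s + -ϱ.1)
  | .boxPlus ϱ H, s => H.shift (s + ϱ.1)

theorem Head.shift_subst (σ : Subst S) (H : Head S (Term S)) (s : Set ℚ) :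
    (H.subst σ).shift s = H.shift s := by
  induction H generalizing s <;> simp_all [Head.subst, Head.shift]

theorem Head.isInterval_shift {τ : Type*} (H : Head S τ) {s : Set ℚ} (hs : IsInterval s) :
    IsInterval (H.shift s) := by
  induction H generalizing s with
  | bot | rel a => exact hs
  | boxMinus ϱ H ih => exact ih (hs.add ϱ.2.1.neg)
  | boxPlus ϱ H ih => exact ih (hs.add ϱ.2.1)

theorem Head.satOn_iff {H : Head S S.Const} {a : GroundAtom S} (ha : H.relAtom = some a)
    {I : Interp S} {s : Set ℚ} : SatOn I H.toMAtom s ↔ SatOn I (.rel a) (H.shift s) := by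
  induction H generalizing s with
  | bot => simp [Head.relAtom] at ha
  | rel b =>
    obtain rfl : b = a := by simpa [Head.relAtom] using ha
    rfl
  | boxMinus ϱ H ih =>
    refine Iff.trans ⟨fun h => ?_, fun h t ht t' ht' => ?_⟩ (ih (s := s + -ϱ.1) ha)
    · rintro _ ⟨t, ht, r, hr, rfl⟩
      exact h t ht _ (by simpa using hr)
    · exact h t' ⟨t, ht, t' - t, by simpa using ht', by simp⟩
  | boxPlus ϱ H ih =>
    refine Iff.trans ⟨fun h => ?_, fun h t ht t' ht' => ?_⟩ (ih (s := s + ϱ.1) ha)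
    · rintro _ ⟨t, ht, r, hr, rfl⟩
      exact h t ht _ (by simpa using hr)
    · exact h t' ⟨t, ht, t' - t, ht', by simp⟩

theorem Head.maximal_iff {H : Head S S.Const} {a : GroundAtom S} (ha : H.relAtom = some a)
    {s : Set ℚ} (hs : IsInterval s) {ϱ : Interval} :
    Maximal (fun ϱ' : Interval => ∀ I : Interp S,
      SatOn I H.toMAtom s → SatOn I (.rel a) ϱ'.1) ϱ ↔ ϱ.1 = H.shift s := by
  have key : ∀ ϱ' : Interval, (∀ I : Interp S, SatOn I H.toMAtom s → SatOn I (.rel a) ϱ'.1) ↔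
      ϱ' ≤ ⟨H.shift s, H.isInterval_shift hs⟩ := by
    refine fun ϱ' => ⟨fun h t ht => ?_, fun h I hI t ht => (Head.satOn_iff ha).1 hI t (h ht)⟩
    -- Test interpretation: every atom holds exactly on the shifted set, so the head holds on `s`
    -- and nothing beyond the shift is forced.
    exact h (fun t => {_b | t ∈ H.shift s}) ((Head.satOn_iff ha).2 fun t ht => ht) t ht
  simp only [key, maximal_le_iff, Subtype.ext_iff]

theorem mem_semiDerived {r : Rule S} {D Δ : FactSet S} {f : Fact S} :
    f ∈ semiDerived r D Δ ↔ f.ivl.1.Nonempty ∧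
      ∃ (σ : Subst S) (ϱ : Fin r.body.length → Interval), IsRelInstance r D Δ σ ϱ ∧
        (r.head.subst σ).relAtom = some f.atom ∧ f.ivl.1 = r.head.shift (⋂ i, (ϱ i).1) := by
  refine and_congr_right fun _ => exists_congr fun σ => exists_congr fun ϱ =>
    and_congr_right fun _ => and_congr_right fun ha => ?_
  rw [Head.maximal_iff ha (isInterval_iInter fun i => (ϱ i).2), Head.shift_subst]

theorem isInstance_iff {r : Rule S} {D : FactSet S} {σ : Subst S}
    {ϱ : Fin r.body.length → Interval} : IsInstance r D σ ϱ ↔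
      ∀ i, Maximal (fun ϱ' : Interval =>
        ϱ'.1 ⊆ satSet (leastModel D) ((r.body.get i).subst σ)) (ϱ i) := by
  simp only [IsInstance, entails_iff]

theorem finite_ivl_semiDerived {D : FactSet S} (hD : (Fact.ivl '' D).Finite) (Δ : FactSet S)
    (r : Rule S) : (Fact.ivl '' semiDerived r D Δ).Finite := by
  let F (i : Fin r.body.length) : Set Interval :=
    ⋃ A ∈ range (fun σ : Subst S => satSet (leastModel D) ((r.body.get i).subst σ)),
      {ϱ | Maximal (fun ϱ' : Interval => ϱ'.1 ⊆ A) ϱ}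
  have hF : ∀ i, (F i).Finite := by
    refine fun i => (finite_range_satSet hD _).biUnion ?_
    rintro _ ⟨σ, rfl⟩
    exact (tame_satSet hD _).finite_maximal_intervals
  refine (((Set.Finite.pi' hF).image fun ϱ => r.head.shift (⋂ i, (ϱ i).1)).preimage
    Subtype.val_injective.injOn).subset ?_
  rintro _ ⟨f, hf, rfl⟩
  obtain ⟨-, σ, ϱ, hϱ, -, hivl⟩ := mem_semiDerived.1 hf
  exact ⟨ϱ, fun i => mem_biUnion ⟨σ, rfl⟩ (isInstance_iff.1 hϱ.1 i), hivl.symm⟩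

theorem finite_ivl_semiApply {Γ : RuleSet S} (hΓ : Γ.Finite) {D : FactSet S}
    (hD : (Fact.ivl '' D).Finite) (Δ : FactSet S) : (Fact.ivl '' semiApply Γ D Δ).Finite := by
  simp only [semiApply, image_iUnion]
  exact hΓ.biUnion fun r _ => finite_ivl_semiDerived hD Δ r

theorem relAtom_subst_eq_some {r : Rule S} (hr : ¬ r.IsBotRule) (σ : Subst S) :
    ∃ a, (r.head.subst σ).relAtom = some a := by
  rw [Head.relAtom_subst]
  obtain ⟨a, ha⟩ := Option.ne_none_iff_exists'.1 hr
  exact ⟨a.subst σ, by rw [ha]; rfl⟩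

/-- Derived facts are immediate consequences. -/
theorem leastModel_semiApply_le (Γ : RuleSet S) (D Δ : FactSet S) :
    leastModel (semiApply Γ D Δ) ≤ immediateConsequence Γ (leastModel D) := by
  rintro t _ ⟨f, hf, rfl, ht⟩
  obtain ⟨r, hr, hf⟩ := mem_iUnion₂.1 hf
  obtain ⟨-, σ, ϱ, hϱ, hatom, hivl⟩ := mem_semiDerived.1 hf
  have hbot : ¬ r.IsBotRule := by
    intro h
    rw [Head.relAtom_subst, h] at hatom
    cases hatom
  rw [hivl, ← Head.shift_subst σ] at ht
  refine (Head.satOn_iff hatom).1 (fun s hs => ?_) t ht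
  refine (immediateConsequence_isLeast Γ (leastModel D)).1.2 r hr hbot σ s fun M hM => ?_
  obtain ⟨i, rfl⟩ := List.get_of_mem hM
  exact (isInstance_iff.1 hϱ.1 i).1 (mem_iInter.1 hs i)

/-- A rule whose body holds either is applied or has its body satisfied by the old facts. -/
theorem sat_head_or_satBody_diff {Γ : RuleSet S} {D : FactSet S} (hD : (Fact.ivl '' D).Finite)
    (Δ : FactSet S) {r : Rule S} (hr : r ∈ Γ) (hbot : ¬ r.IsBotRule) {σ : Subst S} {t : ℚ}
    (h : SatBody (leastModel D) r σ t) :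
    Sat (leastModel (semiApply Γ D Δ)) t (r.head.subst σ).toMAtom ∨
      SatBody (leastModel (D \ Δ)) r σ t := by
  have hex : ∀ i : Fin r.body.length, ∃ ϱ : Interval, t ∈ ϱ.1 ∧
      Maximal (fun ϱ' : Interval =>
        ϱ'.1 ⊆ satSet (leastModel D) ((r.body.get i).subst σ)) ϱ := fun i =>
    (tame_satSet hD _).exists_maximal_interval (h _ (List.get_mem _ _))
  choose ϱ htϱ hϱ using hex
  -- Either the chosen tuple counts as relative to `Δ` and is applied, or all its components are
  -- entailed without `Δ`.
  by_cases hrel : ∃ i, ¬ Entails (D \ Δ) ((r.body.get i).subst σ) (ϱ i).1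
  · left
    obtain ⟨a, ha⟩ := relAtom_subst_eq_some hbot σ
    have hint : IsInterval (⋂ i, (ϱ i).1) := isInterval_iInter fun i => (ϱ i).2
    refine (Head.satOn_iff ha (s := ⋂ i, (ϱ i).1)).2 (fun s hs => ?_) t (mem_iInter.2 htϱ)
    rw [Head.shift_subst] at hs
    refine ⟨⟨a, _, r.head.isInterval_shift hint⟩, mem_biUnion hr ?_, rfl, hs⟩
    exact mem_semiDerived.2 ⟨⟨s, hs⟩, σ, ϱ, ⟨isInstance_iff.2 hϱ, hrel⟩, ha, rfl⟩
  · right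
    push Not at hrel
    intro M hM
    obtain ⟨i, rfl⟩ := List.get_of_mem hM
    exact entails_iff.1 (hrel i) (htϱ i)

/-! ### Stages of materialisation -/

theorem immediateConsequence_mono_rules {Γ Γ' : RuleSet S} (h : Γ' ⊆ Γ) (I : Interp S) :
    immediateConsequence Γ' I ≤ immediateConsequence Γ I :=
  have hc := (immediateConsequence_isLeast Γ I).1
  (immediateConsequence_isLeast Γ' I).2 ⟨hc.1, fun r hr => hc.2 r (h hr)⟩

theorem leastModel_union (D E : FactSet S) : leastModel (D ∪ E) = leastModel D ⊔ leastModel E := by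
  funext t
  ext a
  simp only [leastModel, mem_union, or_and_right, exists_or]
  rfl

/-- A sequence of interpretations obtained by iterating the immediate consequence operator. -/
def IsStages (Γ : RuleSet S) (J : ℕ → Interp S) : Prop :=
  ∀ i, J (i + 1) = immediateConsequence Γ (J i)

theorem IsStages.closedUnder {Γ : RuleSet S} {J : ℕ → Interp S} (hJ : IsStages Γ J) (i : ℕ) :
    ClosedUnder Γ (J i) (J (i + 1)) := by
  rw [hJ i]
  exact (immediateConsequence_isLeast Γ (J i)).1

theorem IsStages.succ_le {Γ : RuleSet S} {J : ℕ → Interp S} (hJ : IsStages Γ J) {i : ℕ}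
    {K : Interp S} (hK : ClosedUnder Γ (J i) K) : J (i + 1) ≤ K := by
  rw [hJ i]
  exact (immediateConsequence_isLeast Γ (J i)).2 hK

theorem IsStages.monotone {Γ : RuleSet S} {J : ℕ → Interp S} (hJ : IsStages Γ J) : Monotone J :=
  monotone_nat_of_le_succ fun i => (hJ.closedUnder i).1

/-- From stage `k` on, nothing new is derived over non-recursive predicates. -/
def StableNonRec (Γ : RuleSet S) (J : ℕ → Interp S) (k : ℕ) : Prop :=
  ∀ i t a, ¬ RecursivePred Γ a.pred → a ∈ J i t → a ∈ J k t

/-- From stage `k` on, the heads of the instances of `r` whose body ever holds are satisfied. -/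
def Exhausted (J : ℕ → Interp S) (k : ℕ) (r : Rule S) : Prop :=
  ∀ i σ t, SatBody (J i) r σ t → Sat (J k) t (r.head.subst σ).toMAtom

def NeverFires (J : ℕ → Interp S) (r : Rule S) : Prop := ∀ i σ t, ¬ SatBody (J i) r σ t

def Rule.Forward (r : Rule S) : Prop := (∀ M ∈ r.body, M.PastOnly) ∧ r.head.FutureOnly

/-- A path through a cycle to a body predicate extends by one edge to the head predicate. A `⊥`-head
has no predicate to extend to. -/
theorem nonRecursiveAtom_of_head {Γ : RuleSet S} {r : Rule S} (hr : r ∈ Γ) (hbot : ¬ r.IsBotRule)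
    (hnr : NonRecursiveAtom Γ r.head.toMAtom) {M : MAtom S (Term S)} (hM : M ∈ r.body) :
    NonRecursiveAtom Γ M := by
  have hne : ∀ H : Head S (Term S), H.relAtom ≠ none → H.toMAtom.preds.Nonempty := by
    intro H hH
    induction H with
    | bot => exact absurd rfl hH
    | rel a => exact ⟨a.pred, rfl⟩
    | boxMinus ϱ H ih | boxPlus ϱ H ih => exact ih hH
  obtain ⟨R, hR⟩ := hne r.head hbot
  rintro Q hQ ⟨P, hP, hPQ⟩
  exact hnr R hR ⟨P, hP, hPQ.tail ⟨r, hr, ⟨M, hM, hQ⟩, hR⟩⟩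

theorem StableNonRec.sat {Γ : RuleSet S} {J : ℕ → Interp S} {k : ℕ} (h : StableNonRec Γ J k)
    {M : MAtom S (Term S)} (hM : NonRecursiveAtom Γ M) {i : ℕ} {σ : Subst S} {t : ℚ}
    (hs : Sat (J i) t (M.subst σ)) : Sat (J k) t (M.subst σ) :=
  hs.of_preds fun a t ha => h i t a (hM _ (by rwa [MAtom.preds_subst] at ha))

theorem StableNonRec.mono {Γ : RuleSet S} {J : ℕ → Interp S} (hJ : IsStages Γ J) {k m : ℕ}
    (hkm : k ≤ m) (h : StableNonRec Γ J k) : StableNonRec Γ J m :=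
  fun i t a ha hi => hJ.monotone hkm t (h i t a ha hi)

theorem Exhausted.mono {Γ : RuleSet S} {J : ℕ → Interp S} (hJ : IsStages Γ J) {k m : ℕ}
    (hkm : k ≤ m) {r : Rule S} (h : Exhausted J k r) : Exhausted J m r :=
  fun i σ t hb => (h i σ t hb).mono (hJ.monotone hkm)

/-- If one step derives nothing new over non-recursive predicates, then no later one does. -/
theorem stableNonRec_of_succ {Γ : RuleSet S} {J : ℕ → Interp S} (hJ : IsStages Γ J) {k : ℕ}
    (h : ∀ t a, ¬ RecursivePred Γ a.pred → a ∈ J (k + 1) t → a ∈ J k t) :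
    StableNonRec Γ J k := by
  intro i
  induction i with
  | zero => exact fun t a _ ha => hJ.monotone (Nat.zero_le k) t ha
  | succ i ih =>
    -- The largest interpretation agreeing with `J k` over non-recursive predicates. All atoms over
    -- recursive predicates hold in it, so recursive heads are satisfied for free.
    let K : Interp S := fun t => {a | ¬ RecursivePred Γ a.pred → a ∈ J k t}
    suffices hK : ClosedUnder Γ (J i) K from fun t a ha hi => hJ.succ_le hK t hi ha
    refine ⟨fun t a hi ha => ih t a ha hi, fun r hr hbot σ t hb => ?_⟩
    by_cases hnr : NonRecursiveAtom Γ r.head.toMAtom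
    · have hb' : SatBody (J k) r σ t := fun M hM => (hb M hM).of_preds fun a t ha =>
        ih t a (nonRecursiveAtom_of_head hr hbot hnr hM _ (by rwa [MAtom.preds_subst] at ha))
      exact ((hJ.closedUnder k).2 r hr hbot σ t hb').mono fun t a ha hna => h t a hna ha
    · have hrec : ∀ H : Head S (Term S), H.relAtom ≠ none → ¬ NonRecursiveAtom Γ H.toMAtom →
          ∀ t, Sat K t (H.subst σ).toMAtom := by
        intro H hH hHr
        induction H with
        | bot => exact absurd rfl hH
        | rel a =>
          intro t hna
          exact absurd (fun P hP => (show P = a.pred from hP) ▸ hna) hHr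
        | boxMinus ϱ H ih | boxPlus ϱ H ih => exact fun t t' _ => ih hH hHr t'
      exact hrec r.head hbot hnr t

theorem StableNonRec.exhausted {Γ : RuleSet S} {J : ℕ → Interp S} (hJ : IsStages Γ J) {k : ℕ}
    (h : StableNonRec Γ J k) {r : Rule S} (hr : r ∈ Γ) (hbot : ¬ r.IsBotRule)
    (hnr : NonRecursiveAtom Γ r.head.toMAtom) : Exhausted J (k + 1) r :=
  fun _ σ t hb => (hJ.closedUnder k).2 r hr hbot σ t fun M hM =>
    h.sat (nonRecursiveAtom_of_head hr hbot hnr hM) (hb M hM)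

theorem mem_timesUpTo_of_le {b : EReal} {t t' : ℚ} (ht : t ∈ timesUpTo b) (h : t' ≤ t) :
    t' ∈ timesUpTo b :=
  (EReal.coe_le_coe_iff.2 (Rat.cast_le.2 h)).trans ht

theorem rightEndpoint_singleton (t : ℚ) : rightEndpoint {t} = ((t : ℝ) : EReal) := by
  simp [rightEndpoint]

/-- The body of a rule holds only up to `tRule`. -/
theorem StableNonRec.mem_timesUpTo {Γ : RuleSet S} {J : ℕ → Interp S} {k : ℕ}
    (h : StableNonRec Γ J k) {D : FactSet S} (hD : leastModel D = J k) {r : Rule S} {i : ℕ}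
    {σ : Subst S} {t : ℚ} (hb : SatBody (J i) r σ t) : t ∈ timesUpTo (tRule Γ D r) := by
  change ((t : ℝ) : EReal) ≤ tRule Γ D r
  refine le_sInf ?_
  rintro _ ⟨M, ⟨hM, hnr⟩, rfl⟩
  -- The one-point interval `{t}` already witnesses a right endpoint `t`.
  refine le_sSup ⟨σ, ⟨{t}, isInterval_singleton t⟩, ?_, (rightEndpoint_singleton t).symm⟩
  rw [entails_iff, hD]
  rintro _ rfl
  exact h.sat hnr (hb M hM)

/-- If nothing new is derived up to `b` in one step, then nothing is in any later step, provided
that the rules which still matter propagate information forward in time only. -/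
theorem stage_subset_upTo {Γ : RuleSet S} {J : ℕ → Interp S} (hJ : IsStages Γ J) {k : ℕ}
    (hst : StableNonRec Γ J k)
    (hrules : ∀ r ∈ Γ, ¬ r.IsBotRule →
      NonRecursiveAtom Γ r.head.toMAtom ∨ NeverFires J r ∨ r.Forward)
    {b : EReal} (hb : ∀ t ∈ timesUpTo b, J (k + 1) t ⊆ J k t) (i : ℕ) :
    ∀ t ∈ timesUpTo b, J i t ⊆ J k t := by
  induction i with
  | zero => exact fun t _ => hJ.monotone (Nat.zero_le k) t
  | succ i ih =>
    -- Unconstrained after `b`: a forward rule firing after `b` has its head satisfied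
    -- automatically, and one firing by `b` has a body that sees only times where `ih` applies.
    let K : Interp S := fun t => {a | t ∈ timesUpTo b → a ∈ J k t}
    suffices hK : ClosedUnder Γ (J i) K from fun t ht a ha => hJ.succ_le hK t ha ht
    refine ⟨fun t a ha ht => ih t ht ha, fun r hr hbot σ t hbody => ?_⟩
    have hstep : J (k + 1) ≤ K := fun t a ha ht => hb t ht ha
    rcases hrules r hr hbot with hnr | hnever | hfwd
    · exact (hst.exhausted hJ hr hbot hnr i σ t hbody).mono hstep
    · exact absurd hbody (hnever i σ t)
    · by_cases ht : t ∈ timesUpTo b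
      · have hbody' : SatBody (J k) r σ t := fun M hM =>
          (hbody M hM).of_past ((hfwd.1 M hM).subst σ)
            fun t' ht' => ih t' (mem_timesUpTo_of_le ht ht')
        exact ((hJ.closedUnder k).2 r hr hbot σ t hbody').mono hstep
      · refine Head.sat_of_future (hfwd.2.subst σ) fun t' ht' => ?_
        exact eq_univ_of_forall fun a ht'b => absurd (mem_timesUpTo_of_le ht'b ht') ht

/-! ### Invariants of the procedure -/

/-- What is known about the current program and the flag, in terms of the stages `k` and `m`. -/
structure ProgInvariant (Γ : RuleSet S) (J : ℕ → Interp S) (k m : ℕ) (P : RuleSet S)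
    (flag : Bool) : Prop where
  subset : P ⊆ Γ
  exhausted : ∀ r ∈ Γ, ¬ r.IsBotRule → r ∉ P → Exhausted J m r
  eq_of_flag : flag = false → P = Γ
  stable : flag = true → StableNonRec Γ J k
  -- Later stages refer to all of `Γ`, so `stage_subset_upTo` must also control the rules that have
  -- been removed.
  removed : flag = true → ∀ r ∈ Γ, ¬ r.IsBotRule → r ∉ P →
    NonRecursiveAtom Γ r.head.toMAtom ∨ NeverFires J r ∨ r.Forward

theorem ProgInvariant.mono {Γ : RuleSet S} {J : ℕ → Interp S} (hJ : IsStages Γ J)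
    {k m k' m' : ℕ} {P : RuleSet S} {flag : Bool} (h : ProgInvariant Γ J k m P flag)
    (hk : k ≤ k') (hm : m ≤ m') : ProgInvariant Γ J k' m' P flag where
  subset := h.subset
  exhausted r hr hbot hP := (h.exhausted r hr hbot hP).mono hJ hm
  eq_of_flag := h.eq_of_flag
  stable hf := (h.stable hf).mono hJ hk
  removed := h.removed

/-- `D` and `C` are consecutive stages, so their agreement gives stability. A non-recursive body
atom unsatisfied at stage `k` then stays so. -/
theorem progInvariant_pruneNonRec {Γ : RuleSet S} {J : ℕ → Interp S} (hJ : IsStages Γ J) {k : ℕ}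
    {D C : FactSet S} (hD : leastModel D = J k) (hC : leastModel C = J (k + 1))
    (hsame : SameNonRec Γ D C) : ProgInvariant Γ J k (k + 1) (pruneNonRec Γ D) true := by
  have hst : StableNonRec Γ J k := by
    refine stableNonRec_of_succ hJ fun t a ha hmem => ?_
    have := hsame ⟨a, {t}, isInterval_singleton t⟩ ha
    simpa [entailsFact_iff, hD, hC, hmem] using this
  have hrem : ∀ r ∈ Γ, ¬ r.IsBotRule → r ∉ pruneNonRec Γ D →
      NonRecursiveAtom Γ r.head.toMAtom ∨ NeverFires J r := by
    intro r hr _ hP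
    by_contra! hcon
    refine hP ⟨⟨hr, hcon.1⟩, ?_⟩
    rintro ⟨M, ⟨hM, hnr⟩, hno⟩
    refine hcon.2 fun i σ t hb => hno σ t (entails_iff.2 ?_)
    rw [hD]
    rintro _ rfl
    exact hst.sat hnr (hb M hM)
  refine ⟨fun r hr => hr.1.1, fun r hr hbot hP => ?_, fun h => by simp at h, fun _ => hst,
    fun _ r hr hbot hP => (hrem r hr hbot hP).imp_right Or.inl⟩
  rcases hrem r hr hbot hP with hnr | hnever
  · exact hst.exhausted hJ hr hbot hnr
  · exact fun i σ t hb => absurd hb (hnever i σ t)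

/-- Whenever the body of a removed rule holds, its time is at most `t_r`, where all stages are
contained in stage `k`. Being past-only, the body held at stage `k`, so the head holds at stage `k +
1`. -/
theorem ProgInvariant.pruneForward {Γ : RuleSet S} {J : ℕ → Interp S} (hJ : IsStages Γ J) {k : ℕ}
    {D C : FactSet S} (hD : leastModel D = J k) (hC : leastModel C = J (k + 1)) {P : RuleSet S}
    (h : ProgInvariant Γ J k (k + 1) P true) (hP : ForwardPropagating P) :
    ProgInvariant Γ J k (k + 1) (pruneForward Γ P D C) true := by
  have hst := h.stable rfl
  have hrules : ∀ r ∈ Γ, ¬ r.IsBotRule →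
      NonRecursiveAtom Γ r.head.toMAtom ∨ NeverFires J r ∨ r.Forward := by
    intro r hr hbot
    by_cases hrP : r ∈ P
    · exact Or.inr (Or.inr (hP r hrP))
    · exact h.removed rfl r hr hbot hrP
  refine ⟨fun r hr => h.subset hr.1, fun r hr hbot hrem => ?_, fun h => by simp at h,
    fun _ => hst, fun _ r hr hbot _ => hrules r hr hbot⟩
  by_cases hrP : r ∈ P
  · have hcomp : CompleteUpTo D C (tRule Γ D r) := by
      by_contra hcon
      exact hrem ⟨hrP, hcon⟩
    have hle : ∀ t ∈ timesUpTo (tRule Γ D r), J (k + 1) t ⊆ J k t := by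
      rw [← hC, ← hD]
      rintro t ht _ ⟨f, hf, rfl, htf⟩
      obtain ⟨g, hg, hgf, hsub⟩ := hcomp f hf ⟨t, htf, ht⟩
      exact ⟨g, hg, hgf, hsub ⟨htf, ht⟩⟩
    intro i σ t hb
    have ht := hst.mem_timesUpTo hD hb
    refine (hJ.closedUnder k).2 r hr hbot σ t fun M hM => ?_
    exact (hb M hM).of_past (((hP r hrP).1 M hM).subst σ) fun t' ht' =>
      stage_subset_upTo hJ hst hrules hle i t' (mem_timesUpTo_of_le ht ht')
  · exact h.exhausted r hr hbot hrP

/-- What holds upon completion of the `k`-th iteration. -/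
structure Invariant (Γ : RuleSet S) (J : ℕ → Interp S) (k : ℕ) (s : State S) : Prop where
  finite : (Fact.ivl '' s.data).Finite
  model : leastModel s.data = J k
  -- Justifies skipping the instances that do not involve `Δ`.
  old : ∀ r ∈ Γ, ¬ r.IsBotRule → ∀ σ t, SatBody (leastModel (s.data \ s.delta)) r σ t →
    Sat (J k) t (r.head.subst σ).toMAtom
  prog : ProgInvariant Γ J k k s.prog s.flag

/-- One round of rule application yields the next stage. -/
theorem Invariant.leastModel_step {Γ : RuleSet S} {J : ℕ → Interp S}
    (hJ : IsStages Γ J) {k : ℕ} {s : State S} (h : Invariant Γ J k s) :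
    leastModel (s.data ∪ semiApply s.prog s.data s.delta) = J (k + 1) := by
  rw [leastModel_union, h.model]
  refine le_antisymm (sup_le (hJ.closedUnder k).1 ?_) (hJ.succ_le ⟨le_sup_left, ?_⟩)
  · refine (leastModel_semiApply_le _ _ _).trans ?_
    rw [h.model, hJ k]
    exact immediateConsequence_mono_rules h.prog.subset _
  · intro r hr hbot σ t hb
    by_cases hrP : r ∈ s.prog
    · rw [← h.model] at hb
      rcases sat_head_or_satBody_diff h.finite s.delta hrP hbot hb with hs | hs
      · exact hs.mono le_sup_right
      · exact (h.old r hr hbot σ t hs).mono le_sup_left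
    · exact (h.prog.exhausted r hr hbot hrP k σ t hb).mono le_sup_left

theorem Invariant.iteration {Γ : RuleSet S} (hΓ : Γ.Finite) {J : ℕ → Interp S}
    (hJ : IsStages Γ J) {k : ℕ} {q : Fact S} {s s' : State S} (h : Invariant Γ J k s)
    (hs : iteration Γ q s = .running s') : Invariant Γ J (k + 1) s' := by
  have hfin : (Fact.ivl '' (s.data ∪ semiApply s.prog s.data s.delta)).Finite := by
    rw [image_union]
    exact h.finite.union (finite_ivl_semiApply (hΓ.subset h.prog.subset) h.finite _)
  have hC : leastModel (coal (s.data ∪ semiApply s.prog s.data s.delta)) = J (k + 1) := by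
    rw [leastModel_coal hfin, h.leastModel_step hJ]
  have hold : ∀ r ∈ Γ, ¬ r.IsBotRule → ∀ σ t,
      SatBody (leastModel (coal (s.data ∪ semiApply s.prog s.data s.delta) \
        {f ∈ coal (s.data ∪ semiApply s.prog s.data s.delta) |
          ∃ g ∈ semiApply s.prog s.data s.delta, EntailsFact {f} g ∧ ¬ EntailsFact s.data g})) r σ t →
        Sat (J (k + 1)) t (r.head.subst σ).toMAtom := fun r hr hbot σ t hb =>
    (hJ.closedUnder k).2 r hr hbot σ t
      (hb.mono ((leastModel_coal_diff_le _ _).trans h.model.le))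
  have hfwd : ∀ P, ProgInvariant Γ J k (k + 1) P true → ForwardPropagating P →
      ProgInvariant Γ J k (k + 1) (DatalogMTL.pruneForward Γ P s.data _) true :=
    fun P hP hPf => hP.pruneForward hJ h.model hC hPf
  unfold DatalogMTL.iteration at hs
  simp only at hs
  split_ifs at hs with _ _ _ hsw <;> cases hs <;>
    refine ⟨finite_ivl_coal hfin, hC, hold, ProgInvariant.mono hJ (k := k) (m := k + 1) ?_
      k.le_succ le_rfl⟩
  · have hnew := progInvariant_pruneNonRec hJ h.model hC (h.prog.eq_of_flag hsw.1 ▸ hsw.2)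
    simp only [if_pos hsw]
    by_cases hf : ForwardPropagating (pruneNonRec Γ s.data)
    · rw [if_pos (by rw [if_pos hsw, if_pos hsw]; exact ⟨rfl, hf⟩)]
      exact hfwd _ hnew hf
    · rw [if_neg (by rw [if_pos hsw, if_pos hsw]; exact fun h => hf h.2)]
      exact hnew
  · have hkeep := h.prog.mono hJ le_rfl k.le_succ
    simp only [if_neg hsw]
    by_cases hf : s.flag = true ∧ ForwardPropagating s.prog
    · rw [if_pos (by rw [if_neg hsw, if_neg hsw]; exact hf)]
      rw [hf.1] at hkeep ⊢
      exact hfwd _ hkeep hf.2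
    · rw [if_neg (by rw [if_neg hsw, if_neg hsw]; exact hf)]
      exact hkeep

theorem invariant_run {Γ : RuleSet S} (hΓ : Γ.Finite) (hvac : ∀ r ∈ Γ, ¬ r.VacuousBody)
    {D : FactSet S} (hD : D.Finite) {J : ℕ → Interp S} (hJ : IsStages Γ J)
    (hJD : J 0 = leastModel D) {q : Fact S} (k : ℕ) {s : State S}
    (hs : run Γ D q k = .running s) : Invariant Γ J k s := by
  induction k generalizing s with
  | zero =>
    cases hs
    refine ⟨hD.image _, hJD.symm, fun r hr _ σ t hb => ?_, subset_rfl,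
      fun r hr _ hP => absurd hr hP, fun _ => rfl, fun h => by simp at h, fun h => by simp at h⟩
    -- Initially `Δ` is all of the data, so the old facts form the empty set and only a vacuous body
    -- could hold.
    refine absurd ⟨σ, t, hb.mono ?_⟩ (hvac r hr)
    rintro t a ⟨f, hf, -⟩
    exact absurd hf.1 hf.2
  | succ k ih =>
    simp only [run] at hs
    split at hs
    · cases hs
    · rename_i s₀ hs₀
      exact (ih hs₀).iteration hΓ hJ hs

end DatalogMTL

theorem theorem5 {S : DatalogMTL.Signature} [Nonempty S.Const]
    (Γ : DatalogMTL.RuleSet S) (hfin : Γ.Finite) (hsafe : ∀ r ∈ Γ, r.Safe)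
    (hvac : ∀ r ∈ Γ, ¬ r.VacuousBody)
    (D : DatalogMTL.FactSet S) (hD : D.Finite) (q : DatalogMTL.Fact S)
    (k : ℕ) (s : DatalogMTL.State S)
    (hrun : DatalogMTL.run Γ D q k = DatalogMTL.Outcome.running s) :
    (DatalogMTL.immediateConsequence Γ)^[k] (DatalogMTL.leastModel D) =
      DatalogMTL.leastModel s.data := by
  have hJ : DatalogMTL.IsStages Γ
      fun i => (DatalogMTL.immediateConsequence Γ)^[i] (DatalogMTL.leastModel D) :=
    fun i => Function.iterate_succ_apply' _ i _
  exact (DatalogMTL.invariant_run hfin hvac hD hJ rfl k hrun).model.symm
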